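/- In the (public-coin) randomized two-party communication model, Alice and Bob hold strings $x,y\in\{0,1\}^n$, share a common random source, and exchange bits; the cost of a protocol is the maximum, over the inputs and the random source, of the total number of bits sent. In the $k$-Hamming distance problem they must decide whether $\|x-y\|_1\le k$. A protocol has error $\delta$ if on every input (or every input satisfying a given promise) its output is wrong with probability at most $\delta$. **Theorem.** For every constant $\delta_0<1/2$ there is a constant $c>0$ such that for all integers $n,k\ge 0$ and all $0<\delta\le\delta_0$ with $k^2\le\delta n$, every $\delta$-error randomized two-party protocol for the $k$-Hamming distance problem on strings of length $n$ (with any number of rounds) has communication cost at least $c\,k\log_2(k/\delta)$ (read as $0$ when $k=0$). The same bound holds for protocols that may output an arbitrary answer when $\|x-y\|_1\notin\{k-2,k,k+2\}$, that is, that only need to output "yes" when $\|x-y\|_1\in\{k-2,k\}$ and "no" when $\|x-y\|_1=k+2$, each with error probability at most $\delta$. It also holds for protocols that only need to distinguish $\|x-y\|_1=k$ from $\|x-y\|_1\in\{k-2,k+2\}$ with error probability at most $\delta$. -/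

import Mathlib

open MeasureTheory

/-- A deterministic two-party communication protocol in which Alice holds `x : X` and Bob holds
`y : Y`.  At an internal node one of the players sends a bit that depends on their own input (the
bits sent earlier are recorded by the node), and the protocol continues in one of two subtrees.
A message that is a longer bit string is a succession of such nodes.
At a leaf one of the players declares the output, which may depend on that player's own input as
well as on the transcript; this covers both the convention that the last player to receive a
message declares the output and the convention that the transcript determines the output. -/
inductive Protocol (X Y : Type*) where
  | aliceOutput (f : X → Bool) : Protocol X Y
  | bobOutput (g : Y → Bool) : Protocol X Y
  | aliceSends (f : X → Bool) (onFalse onTrue : Protocol X Y) : Protocol X Y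
  | bobSends (g : Y → Bool) (onFalse onTrue : Protocol X Y) : Protocol X Y

namespace Protocol

variable {X Y : Type*}

/-- The output of the protocol on the input pair `(x, y)`. -/
def output : Protocol X Y → X → Y → Bool
  | aliceOutput f, x, _ => f x
  | bobOutput g, _, y => g y
  | aliceSends f p q, x, y => if f x then q.output x y else p.output x y
  | bobSends g p q, x, y => if g y then q.output x y else p.output x y

/-- The total number of bits sent between the players on the input pair `(x, y)`. -/
def bits : Protocol X Y → X → Y → ℕ
  | aliceOutput _, _, _ => 0
  | bobOutput _, _, _ => 0
  | aliceSends f p q, x, y => (if f x then q.bits x y else p.bits x y) + 1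
  | bobSends g p q, x, y => (if g y then q.bits x y else p.bits x y) + 1

end Protocol

/-- A randomized two-party protocol: the players see a common random source `ω : Ω` and then run a
deterministic protocol that depends on it. -/
structure RandomizedProtocol (X Y Ω : Type*) [MeasurableSpace Ω] where
  run : Ω → Protocol X Y
  measurable_output : ∀ x y, Measurable fun ω => (run ω).output x y

namespace RandomizedProtocol

variable {X Y Ω : Type*} [MeasurableSpace Ω]

/-- The communication cost: the maximum, over the inputs and the random source, of the total
number of bits sent. -/
noncomputable def cost (P : RandomizedProtocol X Y Ω) : ℕ∞ :=
  ⨆ (ω : Ω) (x : X) (y : Y), ((P.run ω).bits x y : ℕ∞)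

/-- On every input pair satisfying the promise `D`, the output differs from `f` with probability at
most `δ`; on the other input pairs the output is arbitrary. -/
def HasErrorOn (P : RandomizedProtocol X Y Ω) (μ : Measure Ω) (D : X → Y → Prop)
    (f : X → Y → Bool) (δ : ℝ) : Prop :=
  ∀ x y, D x y → μ.real {ω | (P.run ω).output x y ≠ f x y} ≤ δ

end RandomizedProtocol

/-- The `k`-Hamming distance problem on strings of length `n`: is the Hamming distance of the two
strings at most `k`? -/
def hammingProblem (n k : ℕ) (x y : Fin n → Bool) : Bool :=
  decide (hammingDist x y ≤ k)

/-- The problem of deciding whether the Hamming distance of the two strings is exactly `k`. -/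
def exactHammingProblem (n k : ℕ) (x y : Fin n → Bool) : Bool :=
  decide (hammingDist x y = k)

/-- The Hamming distance of the two strings is `k - 2`, `k` or `k + 2`. -/
def HammingPromise (n k : ℕ) (x y : Fin n → Bool) : Prop :=
  hammingDist x y + 2 = k ∨ hammingDist x y = k ∨ hammingDist x y = k + 2

/-!
A `d`-bit protocol splits its accepted inputs into `2 ^ d` rectangles `A ×ˢ B` for each value of
the random source.  Of the correctness requirements only the distances `k` (accept) and `k + 2`
(reject) are used.  Let `x` be uniform and let `y` be reached from `x` by `t` flips of random bits.
For the measure `m_t` of a rectangle under this law, averaging produces a rectangle with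
`m_k ≥ c * 2 ^ (-d)` on which `m_{k+2} ≤ C * δ * m_k` and `m_{k-2} ≤ C * m_k`; the last bound only
uses that acceptance probabilities are at most one.  The linear duality in this step is packaged
in `RectMass`.

Such rectangles have to be small, by two inequalities for the measured heat `m_t = ⟨f, S ^ t g⟩`
of a symmetric nonnegative matrix `S`.  Both come from extending a walk `x_0, …, x_t` from `f` to
`g` by walking from `x_s` to `x_{s+1}`, back to a new `x_s'`, and on from there, always following
the conditional law of the walk.  The density of the extended walk relative to the plain walk of
length `t + 2` depends on the step from `x_{s+1}` to `x_s'` only (`edgeRatio`), and the sum over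
`s` of the expected logarithms telescopes (`sum_edgeWeight_mul_log_edgeRatio`).
* The best `s` gives `m_{t+2} ≥ m_t ^ (1 + 2 / t)` (`measuredHeat_mul_exp_le`), hence
  `d ≥ c * k * log (1 / δ)`.
* The second moment of the sum of the truncated densities over all `s` is bounded through
  `m_{t-2}`, because undoing two extensions leaves a walk of length `t - 2`.  Cauchy–Schwarz then
  gives `m_t ^ 2 ≤ 4 * m_{t+2} * (2 * m_{t-2} + m_t)` unless `m_t ≤ t ^ (-t / 8)`
  (`measuredHeat_sq_le`), hence `d ≥ c * k * log k` as soon as the error is a small constant.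

The walk of length `t` ends at distance `t` unless it repeats a bit, which has probability at most
`t ^ 2 / n`; for small `δ` the assumption `k ^ 2 ≤ δ * n` makes this comparable to `δ`.  For larger
`δ` a majority vote reduces the error, and fixing most of the differing bits replaces `k` by
`k / 1000`, which makes repetitions rare.  For bounded `k` and `1 / δ` it is enough that some bit
has to be sent (`half_le_of_cost_le_zero`).
-/

open scoped Matrix

/-! ### Heat measured by a second vector -/

section Heat

variable {V : Type*} [Fintype V] [DecidableEq V]

/-- The heat configuration `S ^ t f` at time `t`, started from `f`. -/
def heat (S : Matrix V V ℝ) (f : V → ℝ) (t : ℕ) : V → ℝ := (S ^ t) *ᵥ f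

/-- The heat `⟨f, S ^ t g⟩` measured by `f` at time `t`, started from `g`. -/
def measuredHeat (S : Matrix V V ℝ) (f g : V → ℝ) (t : ℕ) : ℝ := ∑ x, f x * heat S g t x

/-- The weight with which the step from `z` to `w`, after `s` earlier steps and before `r` later
ones, occurs among the walks from `f` to `g`. -/
def edgeWeight (S : Matrix V V ℝ) (f g : V → ℝ) (s r : ℕ) (z w : V) : ℝ :=
  heat S f s z * S z w * heat S g r w

/-- Take `s + 1` steps, then one step from the point `w` reached to a fresh predecessor `z` of `w`,
then `r + 1` steps on from `z`, always following the conditional law of the walks of length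
`s + r + 1` from `f` to `g`.  This is the density of that walk of length `s + r + 3` with respect
to the plain walk, up to the factor `measuredHeat S f g (s + r + 1)`; it depends on the step from
`w` to `z` only. -/
noncomputable def edgeRatio (S : Matrix V V ℝ) (f g : V → ℝ) (s r : ℕ) (w z : V) : ℝ :=
  (heat S f s z * heat S g r w) / (heat S f (s + 1) w * heat S g (r + 1) z)

variable {S : Matrix V V ℝ} {f g : V → ℝ}

@[simp] lemma heat_zero : heat S f 0 = f := by simp [heat]

lemma heat_succ (t : ℕ) (z : V) : heat S f (t + 1) z = ∑ w, S z w * heat S f t w := by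
  simp only [heat, pow_succ', ← Matrix.mulVec_mulVec]
  rfl

lemma heat_nonneg (hS : ∀ x y, 0 ≤ S x y) (hf : ∀ x, 0 ≤ f x) (t : ℕ) (z : V) :
    0 ≤ heat S f t z := by
  induction t generalizing z with
  | zero => simpa using hf z
  | succ t ih =>
    rw [heat_succ]
    exact Finset.sum_nonneg fun w _ => mul_nonneg (hS _ _) (ih w)

lemma sum_heat_mul_heat (hS : S.IsSymm) (s r : ℕ) :
    ∑ z, heat S f s z * heat S g r z = measuredHeat S f g (s + r) := by
  have h := Matrix.dotProduct_mulVec f (S ^ s) ((S ^ r) *ᵥ g)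
  rw [Matrix.mulVec_mulVec, ← pow_add, ← Matrix.mulVec_transpose, (hS.pow s).eq] at h
  exact h.symm

lemma measuredHeat_nonneg (hS : ∀ x y, 0 ≤ S x y) (hf : ∀ x, 0 ≤ f x) (hg : ∀ x, 0 ≤ g x)
    (t : ℕ) : 0 ≤ measuredHeat S f g t :=
  Finset.sum_nonneg fun x _ => mul_nonneg (hf x) (heat_nonneg hS hg t x)

lemma measuredHeat_comm (hS : S.IsSymm) (t : ℕ) :
    measuredHeat S f g t = measuredHeat S g f t := by
  have h := sum_heat_mul_heat (f := f) (g := g) hS t 0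
  rw [Nat.add_zero] at h
  rw [← h]
  exact Finset.sum_congr rfl fun z _ => by rw [heat_zero, mul_comm]

/-- Summing the weight of a step over its end point leaves the law of its starting point. -/
lemma sum_edgeWeight_right (s r : ℕ) (z : V) :
    ∑ w, edgeWeight S f g s r z w = heat S f s z * heat S g (r + 1) z := by
  rw [heat_succ, Finset.mul_sum]
  exact Finset.sum_congr rfl fun w _ => by rw [edgeWeight]; ring

lemma sum_edgeWeight_left (hS : S.IsSymm) (s r : ℕ) (w : V) :
    ∑ z, edgeWeight S f g s r z w = heat S f (s + 1) w * heat S g r w := by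
  rw [heat_succ, Finset.sum_mul]
  exact Finset.sum_congr rfl fun z _ => by rw [edgeWeight, hS.apply]; ring

lemma sum_edgeWeight (hS : S.IsSymm) (s r : ℕ) :
    ∑ z, ∑ w, edgeWeight S f g s r z w = measuredHeat S f g (s + r + 1) := by
  simp only [sum_edgeWeight_right, sum_heat_mul_heat hS]
  rfl

lemma edgeWeight_nonneg (hS : ∀ x y, 0 ≤ S x y) (hf : ∀ x, 0 ≤ f x) (hg : ∀ x, 0 ≤ g x)
    (s r : ℕ) (z w : V) : 0 ≤ edgeWeight S f g s r z w :=
  mul_nonneg (mul_nonneg (heat_nonneg hS hf _ _) (hS _ _)) (heat_nonneg hS hg _ _)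

lemma edgeRatio_nonneg (hS : ∀ x y, 0 ≤ S x y) (hf : ∀ x, 0 ≤ f x) (hg : ∀ x, 0 ≤ g x)
    (s r : ℕ) (w z : V) : 0 ≤ edgeRatio S f g s r w z :=
  div_nonneg (mul_nonneg (heat_nonneg hS hf _ _) (heat_nonneg hS hg _ _))
    (mul_nonneg (heat_nonneg hS hf _ _) (heat_nonneg hS hg _ _))

/-- On a step that occurs at all, no factor of `edgeRatio` vanishes. -/
lemma heat_pos_of_edgeWeight_ne_zero (hsymm : S.IsSymm) (hS : ∀ x y, 0 ≤ S x y)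
    (hf : ∀ x, 0 ≤ f x) (hg : ∀ x, 0 ≤ g x) {s r : ℕ} {z w : V}
    (h : edgeWeight S f g s r z w ≠ 0) :
    0 < heat S f s z ∧ 0 < heat S g r w ∧ 0 < heat S f (s + 1) w ∧ 0 < heat S g (r + 1) z := by
  rw [edgeWeight, mul_ne_zero_iff, mul_ne_zero_iff] at h
  obtain ⟨⟨h1, h2⟩, h3⟩ := h
  have p1 := lt_of_le_of_ne (heat_nonneg hS hf s z) h1.symm
  have p2 := lt_of_le_of_ne (hS z w) h2.symm
  have p3 := lt_of_le_of_ne (heat_nonneg hS hg r w) h3.symm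
  refine ⟨p1, p3, ?_, ?_⟩
  · rw [heat_succ]
    refine lt_of_lt_of_le (mul_pos (hsymm.apply z w ▸ p2 : 0 < S w z) p1)
      (Finset.single_le_sum (f := fun y => S w y * heat S f s y)
        (fun y _ => mul_nonneg (hS _ _) (heat_nonneg hS hf _ _)) (Finset.mem_univ z))
  · rw [heat_succ]
    refine lt_of_lt_of_le (mul_pos p2 p3)
      (Finset.single_le_sum (f := fun y => S z y * heat S g r y)
        (fun y _ => mul_nonneg (hS _ _) (heat_nonneg hS hg _ _)) (Finset.mem_univ w))

/-- The left side is the measured heat at time `s + r + 3`, restricted to walks whose step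
`s + 1` is the reverse of a step that can occur in a walk of length `s + r + 1`. -/
lemma sum_edgeWeight_mul_inv_edgeRatio_le (hsymm : S.IsSymm) (hS : ∀ x y, 0 ≤ S x y)
    (hf : ∀ x, 0 ≤ f x) (hg : ∀ x, 0 ≤ g x) (s r : ℕ) :
    ∑ z, ∑ w, edgeWeight S f g s r z w * (edgeRatio S f g s r w z)⁻¹
      ≤ measuredHeat S f g (s + r + 3) := by
  have h := sum_edgeWeight (f := f) (g := g) hsymm (s + 1) (r + 1)
  rw [Finset.sum_comm, show s + 1 + (r + 1) + 1 = s + r + 3 by ring] at h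
  rw [← h]
  refine Finset.sum_le_sum fun z _ => Finset.sum_le_sum fun w _ => ?_
  by_cases h0 : edgeWeight S f g s r z w = 0
  · rw [h0, zero_mul]
    exact edgeWeight_nonneg hS hf hg _ _ _ _
  · obtain ⟨h1, h2, h3, h4⟩ := heat_pos_of_edgeWeight_ne_zero hsymm hS hf hg h0
    rw [edgeWeight, edgeRatio, edgeWeight, hsymm.apply z w]
    refine le_of_eq ?_
    field_simp

/-- Summed over the position of the step, the expected logarithm of the ratio telescopes. -/
lemma sum_edgeWeight_mul_log_edgeRatio (hsymm : S.IsSymm) (hS : ∀ x y, 0 ≤ S x y)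
    (hf : ∀ x, 0 ≤ f x) (hg : ∀ x, 0 ≤ g x) (t : ℕ) :
    ∑ s ∈ Finset.range t, ∑ z, ∑ w,
        edgeWeight S f g s (t - 1 - s) z w * Real.log (edgeRatio S f g s (t - 1 - s) w z)
      = ∑ z, f z * heat S g t z * (Real.log (f z) - Real.log (heat S g t z))
        + ∑ z, g z * heat S f t z * (Real.log (g z) - Real.log (heat S f t z)) := by
  set Λ : ℕ → ℝ := fun s => ∑ z, heat S f s z * heat S g (t - s) z *
    (Real.log (heat S f s z) - Real.log (heat S g (t - s) z)) with hΛ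
  have key : ∀ s ∈ Finset.range t, ∑ z, ∑ w,
      edgeWeight S f g s (t - 1 - s) z w * Real.log (edgeRatio S f g s (t - 1 - s) w z)
      = Λ s - Λ (s + 1) := by
    intro s hs
    obtain ⟨r, hr⟩ : ∃ r, t = s + r + 1 := ⟨t - 1 - s, by have := Finset.mem_range.1 hs; omega⟩
    have e1 : t - 1 - s = r := by omega
    have e2 : t - s = r + 1 := by omega
    have e3 : t - (s + 1) = r := by omega
    simp only [hΛ, e1, e2, e3]
    have hpt : ∀ z w, edgeWeight S f g s r z w * Real.log (edgeRatio S f g s r w z)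
        = edgeWeight S f g s r z w * (Real.log (heat S f s z) - Real.log (heat S g (r + 1) z))
        - edgeWeight S f g s r z w *
          (Real.log (heat S f (s + 1) w) - Real.log (heat S g r w)) := by
      intro z w
      by_cases h0 : edgeWeight S f g s r z w = 0
      · simp [h0]
      · obtain ⟨h1, h2, h3, h4⟩ := heat_pos_of_edgeWeight_ne_zero hsymm hS hf hg h0
        rw [edgeRatio, Real.log_div (by positivity) (by positivity),
          Real.log_mul h1.ne' h2.ne', Real.log_mul h3.ne' h4.ne']
        ring
    simp only [hpt, Finset.sum_sub_distrib]
    congr 1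
    · exact Finset.sum_congr rfl fun z _ => by rw [← Finset.sum_mul, sum_edgeWeight_right]
    · rw [Finset.sum_comm]
      exact Finset.sum_congr rfl fun w _ => by rw [← Finset.sum_mul, sum_edgeWeight_left hsymm]
  rw [Finset.sum_congr rfl key, Finset.sum_range_sub']
  simp only [hΛ, Nat.sub_zero, Nat.sub_self, heat_zero, sub_eq_add_neg (∑ z, _),
    ← Finset.sum_neg_distrib]
  congr 1
  exact Finset.sum_congr rfl fun z _ => by ring

/-- The relative entropy bound at an end point of the walk, by Jensen's inequality. -/
lemma sum_mul_log_sub_log_le {Z : ℝ} (hS : ∀ x y, 0 ≤ S x y)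
    (hf : ∀ x, 0 ≤ f x) (hf1 : ∀ x, f x ≤ 1) (hg : ∀ x, 0 ≤ g x) (hZ : ∑ x, f x ≤ Z) (t : ℕ)
    (ha : 0 < measuredHeat S f g t) (hZ0 : 0 < Z) :
    ∑ z, f z * heat S g t z * (Real.log (f z) - Real.log (heat S g t z))
      ≤ measuredHeat S f g t * Real.log (Z / measuredHeat S f g t) := by
  set a := measuredHeat S f g t with ha_def
  have hc : 0 < Z / a := by positivity
  have key : ∀ z, f z * heat S g t z * (Real.log (f z) - Real.log (heat S g t z))
      ≤ f z * (a / Z) - f z * heat S g t z + f z * heat S g t z * Real.log (Z / a) := by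
    intro z
    have hq := heat_nonneg hS hg t z
    rcases (hf z).eq_or_lt with h | h
    · simp [← h]
    rcases hq.eq_or_lt with h' | h'
    · rw [← h']
      have : 0 ≤ f z * (a / Z) := by positivity
      simpa using this
    have hl := Real.log_le_sub_one_of_pos (x := f z / (heat S g t z * (Z / a))) (by positivity)
    rw [Real.log_div h.ne' (by positivity), Real.log_mul h'.ne' hc.ne'] at hl
    have h2 : f z * heat S g t z * (f z / (heat S g t z * (Z / a))) = f z * f z * (a / Z) := by
      field_simp
    have h3 : f z * f z * (a / Z) ≤ f z * (a / Z) := by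
      have : 0 < a / Z := by positivity
      have := hf1 z
      gcongr
      nlinarith
    have h4 := mul_le_mul_of_nonneg_left hl (mul_pos h h').le
    nlinarith
  refine (Finset.sum_le_sum fun z _ => key z).trans ?_
  rw [Finset.sum_add_distrib, Finset.sum_sub_distrib, ← Finset.sum_mul, ← Finset.sum_mul]
  change (∑ z, f z) * (a / Z) - a + a * _ ≤ _
  have : (∑ z, f z) * (a / Z) ≤ Z * (a / Z) := by gcongr
  rw [mul_div_cancel₀ _ hZ0.ne'] at this
  linarith

lemma sum_edgeWeight_mul_log_edgeRatio_le {Z : ℝ} (hsymm : S.IsSymm) (hS : ∀ x y, 0 ≤ S x y)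
    (hf : ∀ x, 0 ≤ f x) (hf1 : ∀ x, f x ≤ 1) (hg : ∀ x, 0 ≤ g x) (hg1 : ∀ x, g x ≤ 1)
    (hfZ : ∑ x, f x ≤ Z) (hgZ : ∑ x, g x ≤ Z) (hZ : 0 < Z) (t : ℕ)
    (ha : 0 < measuredHeat S f g t) :
    ∑ s ∈ Finset.range t, ∑ z, ∑ w,
        edgeWeight S f g s (t - 1 - s) z w * Real.log (edgeRatio S f g s (t - 1 - s) w z)
      ≤ 2 * (measuredHeat S f g t * Real.log (Z / measuredHeat S f g t)) := by
  rw [sum_edgeWeight_mul_log_edgeRatio hsymm hS hf hg]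
  have h1 := sum_mul_log_sub_log_le hS hf hf1 hg hfZ t ha hZ
  have h2 := sum_mul_log_sub_log_le hS hg hg1 hf hgZ t (measuredHeat_comm hsymm t ▸ ha) hZ
  rw [measuredHeat_comm hsymm (f := g)] at h2
  linarith

/-- Repeating one step of a walk of length `t`, at the best position, gives
`m_{t+2} ≥ m_t ^ (1 + 2 / t)` for the measured heat `m_t`, here normalized by `Z`. -/
theorem measuredHeat_mul_exp_le {Z : ℝ} (hsymm : S.IsSymm) (hS : ∀ x y, 0 ≤ S x y)
    (hf : ∀ x, 0 ≤ f x) (hf1 : ∀ x, f x ≤ 1) (hg : ∀ x, 0 ≤ g x) (hg1 : ∀ x, g x ≤ 1)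
    (hfZ : ∑ x, f x ≤ Z) (hgZ : ∑ x, g x ≤ Z) (hZ : 0 < Z) {t : ℕ} (ht : 0 < t)
    (ha : 0 < measuredHeat S f g t) :
    measuredHeat S f g t * Real.exp (-(2 / t * Real.log (Z / measuredHeat S f g t)))
      ≤ measuredHeat S f g (t + 2) := by
  set a := measuredHeat S f g t with ha_def
  set l := 2 / t * Real.log (Z / a) with hl
  have ht' : (0 : ℝ) < t := by exact_mod_cast ht
  -- Some position has at most the average logarithmic ratio.
  obtain ⟨s, hs, hle⟩ : ∃ s ∈ Finset.range t, ∑ z, ∑ w,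
      edgeWeight S f g s (t - 1 - s) z w * Real.log (edgeRatio S f g s (t - 1 - s) w z)
        ≤ a * l := by
    apply Finset.exists_le_of_sum_le (Finset.nonempty_range_iff.2 ht.ne')
    refine (sum_edgeWeight_mul_log_edgeRatio_le hsymm hS hf hf1 hg hg1 hfZ hgZ hZ t ha).trans ?_
    rw [Finset.sum_const, Finset.card_range, nsmul_eq_mul, hl]
    refine le_of_eq ?_
    field_simp
    rfl
  obtain ⟨r, hr⟩ : ∃ r, t = s + r + 1 := ⟨t - 1 - s, by have := Finset.mem_range.1 hs; omega⟩
  have e1 : t - 1 - s = r := by omega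
  rw [e1] at hle
  have hsum : ∑ z, ∑ w, edgeWeight S f g s r z w = a := by
    rw [sum_edgeWeight hsymm, ha_def, hr]
  have hup := sum_edgeWeight_mul_inv_edgeRatio_le hsymm hS hf hg s r
  rw [show s + r + 3 = t + 2 by omega] at hup
  refine le_trans ?_ hup
  have key : ∀ z w, Real.exp (-l) * ((1 + l) * edgeWeight S f g s r z w
      - edgeWeight S f g s r z w * Real.log (edgeRatio S f g s r w z))
      ≤ edgeWeight S f g s r z w * (edgeRatio S f g s r w z)⁻¹ := by
    intro z w
    by_cases h0 : edgeWeight S f g s r z w = 0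
    · simp [h0]
    · obtain ⟨h1, h2, h3, h4⟩ := heat_pos_of_edgeWeight_ne_zero hsymm hS hf hg h0
      have hpos : 0 < edgeRatio S f g s r w z := by rw [edgeRatio]; positivity
      have hw := edgeWeight_nonneg hS hf hg s r z w
      -- The tangent line of `exp (-·)` at `l` replaces Jensen's inequality.
      have h5 : (edgeRatio S f g s r w z)⁻¹
          = Real.exp (-l) * Real.exp (l - Real.log (edgeRatio S f g s r w z)) := by
        rw [← Real.exp_add, neg_add_eq_sub, sub_sub_cancel_left, Real.exp_neg, Real.exp_log hpos]
      have h6 := Real.add_one_le_exp (l - Real.log (edgeRatio S f g s r w z))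
      rw [h5]
      have h7 := mul_le_mul_of_nonneg_left h6 (mul_nonneg hw (Real.exp_pos (-l)).le)
      nlinarith
  refine le_trans ?_ (Finset.sum_le_sum fun z _ => Finset.sum_le_sum fun w _ => key z w)
  simp only [← Finset.mul_sum, Finset.sum_sub_distrib, hsum]
  have := Real.exp_pos (-l)
  nlinarith

end Heat

/-! ### The second moment of the number of reversed steps -/

section SecondMoment

variable {V : Type*} [Fintype V] [DecidableEq V]

/-- The sum over the walks `x_0, …, x_{s+1}` from `f` to `z`, weighted by `f` and `S`, of
`∑ i < s, ρ i x_{i+1} x_{i+2}`.  The recursion avoids sums over paths. -/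
def walkSum (S : Matrix V V ℝ) (f : V → ℝ) (ρ : ℕ → V → V → ℝ) : ℕ → V → ℝ
  | 0 => 0
  | s + 1 => fun z => ∑ w, S z w * (walkSum S f ρ s w + ρ s w z * heat S f (s + 1) w)

/-- The same weighted sum as `walkSum`, of the squares of `∑ i < s, ρ i x_{i+1} x_{i+2}`. -/
def walkSqSum (S : Matrix V V ℝ) (f : V → ℝ) (ρ : ℕ → V → V → ℝ) : ℕ → V → ℝ
  | 0 => 0
  | s + 1 => fun z => ∑ w, S z w *
      (walkSqSum S f ρ s w + 2 * ρ s w z * walkSum S f ρ s w + ρ s w z ^ 2 * heat S f (s + 1) w)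

/-- The density `edgeRatio` along walks of length `t`, cut off to zero where it exceeds `t`. -/
noncomputable def truncRatio (S : Matrix V V ℝ) (f g : V → ℝ) (t s : ℕ) (w z : V) : ℝ :=
  if edgeRatio S f g s (t - 1 - s) w z ≤ t then edgeRatio S f g s (t - 1 - s) w z else 0

variable {S : Matrix V V ℝ} {f g : V → ℝ} {ρ : ℕ → V → V → ℝ}

lemma sum_sq_le_sum_mul_sum {ι : Type*} [Fintype ι] {c a b d : ι → ℝ}
    (hc : ∀ x, 0 ≤ c x) (ha : ∀ x, 0 ≤ a x) (hd : ∀ x, 0 ≤ d x) (h : ∀ x, b x ^ 2 ≤ a x * d x) :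
    (∑ x, c x * b x) ^ 2 ≤ (∑ x, c x * a x) * ∑ x, c x * d x := by
  have h1 : |∑ x, c x * b x| ≤ ∑ x, √(c x * a x) * √(c x * d x) := by
    refine (Finset.abs_sum_le_sum_abs _ _).trans (Finset.sum_le_sum fun x _ => ?_)
    rw [← Real.sqrt_mul (mul_nonneg (hc x) (ha x))]
    refine Real.abs_le_sqrt ?_
    nlinarith [mul_le_mul_of_nonneg_left (h x) (mul_nonneg (hc x) (hc x))]
  have h2 := Finset.sum_mul_sq_le_sq_mul_sq Finset.univ
    (fun x => √(c x * a x)) (fun x => √(c x * d x))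
  simp only [Real.sq_sqrt (mul_nonneg (hc _) (ha _)), Real.sq_sqrt (mul_nonneg (hc _) (hd _))]
    at h2
  refine le_trans ?_ h2
  rw [← sq_abs]
  gcongr

lemma walkSum_nonneg (hS : ∀ x y, 0 ≤ S x y) (hf : ∀ x, 0 ≤ f x) (hρ : ∀ s w z, 0 ≤ ρ s w z)
    (s : ℕ) (z : V) : 0 ≤ walkSum S f ρ s z := by
  induction s generalizing z with
  | zero => simp [walkSum]
  | succ s ih =>
    exact Finset.sum_nonneg fun w _ => mul_nonneg (hS _ _)
      (add_nonneg (ih w) (mul_nonneg (hρ _ _ _) (heat_nonneg hS hf _ _)))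

lemma walkSqSum_nonneg (hS : ∀ x y, 0 ≤ S x y) (hf : ∀ x, 0 ≤ f x)
    (hρ : ∀ s w z, 0 ≤ ρ s w z) (s : ℕ) (z : V) : 0 ≤ walkSqSum S f ρ s z := by
  induction s generalizing z with
  | zero => simp [walkSqSum]
  | succ s ih =>
    refine Finset.sum_nonneg fun w _ => mul_nonneg (hS _ _) ?_
    have h1 := ih w
    have h2 := walkSum_nonneg hS hf hρ s w
    have h3 := hρ s w z
    have h4 := heat_nonneg hS hf (s + 1) w
    positivity

/-- The Cauchy–Schwarz inequality over the walks ending at `z`. -/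
lemma walkSum_sq_le (hS : ∀ x y, 0 ≤ S x y) (hf : ∀ x, 0 ≤ f x) (hρ : ∀ s w z, 0 ≤ ρ s w z)
    (s : ℕ) (z : V) :
    walkSum S f ρ s z ^ 2 ≤ heat S f (s + 1) z * walkSqSum S f ρ s z := by
  induction s generalizing z with
  | zero => simp [walkSum, walkSqSum]
  | succ s ih =>
    rw [heat_succ]
    refine sum_sq_le_sum_mul_sum (hS z) (fun w => heat_nonneg hS hf _ w) (fun w => ?_)
      (fun w => ?_)
    · have h1 := walkSqSum_nonneg hS hf hρ s w
      have h2 := walkSum_nonneg hS hf hρ s w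
      have h3 := hρ s w z
      have h4 := heat_nonneg hS hf (s + 1) w
      positivity
    · nlinarith [ih w]

lemma sum_walkSum_mul_heat (hsymm : S.IsSymm) (t : ℕ) :
    ∑ z, walkSum S f ρ t z * heat S g 1 z
      = ∑ s ∈ Finset.range t, ∑ z, ∑ w,
          S z w * (ρ s w z * heat S f (s + 1) w) * heat S g (t - s) z := by
  set D : ℕ → ℝ := fun s => ∑ z, walkSum S f ρ s z * heat S g (t + 1 - s) z with hD
  have key : ∀ s ∈ Finset.range t, ∑ z, ∑ w,
      S z w * (ρ s w z * heat S f (s + 1) w) * heat S g (t - s) z = D (s + 1) - D s := by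
    intro s hs
    have e1 : t + 1 - (s + 1) = t - s := by omega
    have e2 : t + 1 - s = (t - s) + 1 := by have := Finset.mem_range.1 hs; omega
    simp only [hD, e1, e2, heat_succ (f := g), walkSum, Finset.mul_sum, Finset.sum_mul, mul_add,
      add_mul, Finset.sum_add_distrib]
    rw [add_comm (∑ z, ∑ w, S z w * walkSum S f ρ s w * _), eq_sub_iff_add_eq]
    congr 1
    rw [Finset.sum_comm]
    exact Finset.sum_congr rfl fun z _ => Finset.sum_congr rfl fun w _ => by
      rw [hsymm.apply z w]; ring
  rw [Finset.sum_congr rfl key, Finset.sum_range_sub]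
  simp [hD, walkSum]

lemma sum_walkSqSum_mul_heat (hsymm : S.IsSymm) (t : ℕ) :
    ∑ z, walkSqSum S f ρ t z * heat S g 1 z
      = ∑ s ∈ Finset.range t, ∑ z, ∑ w, S z w * (2 * ρ s w z * walkSum S f ρ s w
          + ρ s w z ^ 2 * heat S f (s + 1) w) * heat S g (t - s) z := by
  set D : ℕ → ℝ := fun s => ∑ z, walkSqSum S f ρ s z * heat S g (t + 1 - s) z with hD
  have key : ∀ s ∈ Finset.range t, ∑ z, ∑ w, S z w * (2 * ρ s w z * walkSum S f ρ s w
          + ρ s w z ^ 2 * heat S f (s + 1) w) * heat S g (t - s) z = D (s + 1) - D s := by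
    intro s hs
    have e1 : t + 1 - (s + 1) = t - s := by omega
    have e2 : t + 1 - s = (t - s) + 1 := by have := Finset.mem_range.1 hs; omega
    simp only [hD, e1, e2, heat_succ (f := g), walkSqSum, add_assoc]
    simp only [Finset.mul_sum, Finset.sum_mul, mul_add, add_mul, Finset.sum_add_distrib]
    rw [add_comm (∑ z, ∑ w, S z w * walkSqSum S f ρ s w * _), eq_sub_iff_add_eq]
    congr 1
    rw [Finset.sum_comm]
    exact Finset.sum_congr rfl fun z _ => Finset.sum_congr rfl fun w _ => by
      rw [hsymm.apply z w]; ring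
  rw [Finset.sum_congr rfl key, Finset.sum_range_sub]
  simp [hD, walkSqSum]

lemma truncRatio_nonneg (hS : ∀ x y, 0 ≤ S x y) (hf : ∀ x, 0 ≤ f x) (hg : ∀ x, 0 ≤ g x)
    (t s : ℕ) (w z : V) : 0 ≤ truncRatio S f g t s w z := by
  rw [truncRatio]
  split_ifs
  exacts [edgeRatio_nonneg hS hf hg _ _ _ _, le_rfl]

lemma truncRatio_le (t s : ℕ) (w z : V) : truncRatio S f g t s w z ≤ t := by
  rw [truncRatio]
  split_ifs with h
  exacts [h, Nat.cast_nonneg t]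

lemma truncRatio_le_edgeRatio (hS : ∀ x y, 0 ≤ S x y) (hf : ∀ x, 0 ≤ f x) (hg : ∀ x, 0 ≤ g x)
    (t s : ℕ) (w z : V) : truncRatio S f g t s w z ≤ edgeRatio S f g s (t - 1 - s) w z := by
  rw [truncRatio]
  split_ifs
  exacts [le_rfl, edgeRatio_nonneg hS hf hg _ _ _ _]

lemma mul_div_mul_mul_cancel_le {a b c d : ℝ} (ha : 0 ≤ a) (hb : 0 ≤ b) (hd : 0 ≤ d) :
    a * b / (c * d) * c ≤ a * (b / d) := by
  rcases eq_or_ne c 0 with rfl | hc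
  · rw [mul_zero]; positivity
  · refine le_of_eq ?_
    rw [mul_div_assoc, mul_comm c d, ← div_div]
    field_simp

/-- Undoing the density: the walks weighted by the truncated density of the repetition of their
last step dominate no more than the walks that are two steps shorter. -/
lemma sum_truncRatio_mul_heat_le (hS : ∀ x y, 0 ≤ S x y) (hf : ∀ x, 0 ≤ f x)
    (hg : ∀ x, 0 ≤ g x) (t s : ℕ) (z : V) :
    ∑ w, S z w * (truncRatio S f g t s w z * heat S f (s + 1) w) ≤ heat S f s z := by
  set r := t - 1 - s with hr
  have hq := heat_nonneg hS hg (r + 1) z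
  have hp := heat_nonneg hS hf s z
  have key : ∀ w, S z w * (truncRatio S f g t s w z * heat S f (s + 1) w)
      ≤ S z w * heat S g r w * (heat S f s z / heat S g (r + 1) z) := by
    intro w
    have h1 := truncRatio_le_edgeRatio hS hf hg t s w z
    have h2 := heat_nonneg hS hf (s + 1) w
    have h3 := heat_nonneg hS hg r w
    calc S z w * (truncRatio S f g t s w z * heat S f (s + 1) w)
        ≤ S z w * (edgeRatio S f g s r w z * heat S f (s + 1) w) := by
          gcongr
          exact hS z w
      _ ≤ S z w * (heat S f s z * (heat S g r w / heat S g (r + 1) z)) := by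
          refine mul_le_mul_of_nonneg_left ?_ (hS z w)
          exact mul_div_mul_mul_cancel_le hp h3 hq
      _ = _ := by ring
  refine (Finset.sum_le_sum fun w _ => key w).trans ?_
  rw [← Finset.sum_mul, ← heat_succ]
  rcases hq.eq_or_lt with h | h
  · rw [← h]; simpa using hp
  · exact le_of_eq (mul_div_cancel₀ _ h.ne')

lemma walkSum_truncRatio_le (hS : ∀ x y, 0 ≤ S x y) (hf : ∀ x, 0 ≤ f x)
    (hg : ∀ x, 0 ≤ g x) (t s : ℕ) (z : V) :
    walkSum S f (truncRatio S f g t) s z ≤ s * heat S f (s - 1) z := by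
  induction s generalizing z with
  | zero => simp [walkSum]
  | succ s ih =>
    have h1 := sum_truncRatio_mul_heat_le hS hf hg t s z
    have h2 : ∑ w, S z w * walkSum S f (truncRatio S f g t) s w ≤ s * heat S f s z := by
      refine (Finset.sum_le_sum fun w _ => mul_le_mul_of_nonneg_left (ih w) (hS z w)).trans ?_
      rcases s with _ | s
      · simp
      · rw [heat_succ, Finset.mul_sum]
        exact le_of_eq (Finset.sum_congr rfl fun w _ => by simp; ring)
    have h3 : walkSum S f (truncRatio S f g t) (s + 1) z
        = ∑ w, (S z w * walkSum S f (truncRatio S f g t) s w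
          + S z w * (truncRatio S f g t s w z * heat S f (s + 1) w)) :=
      Finset.sum_congr rfl fun w _ => mul_add _ _ _
    rw [h3, Finset.sum_add_distrib, Nat.add_sub_cancel]
    push_cast
    linarith

/-- Two repeated steps at different positions leave a walk two steps shorter than the original
one, which is where `measuredHeat S f g (t - 2)` comes from. -/
lemma sum_truncRatio_mul_walkSum_le (hsymm : S.IsSymm) (hS : ∀ x y, 0 ≤ S x y)
    (hf : ∀ x, 0 ≤ f x) (hg : ∀ x, 0 ≤ g x) {t s : ℕ} (hs : s < t) :
    ∑ z, ∑ w, S z w * (truncRatio S f g t s w z * walkSum S f (truncRatio S f g t) s w)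
      * heat S g (t - s) z ≤ t * measuredHeat S f g (t - 2) := by
  have hm := measuredHeat_nonneg hS hf hg (t - 2)
  rcases s with _ | s
  · simp only [walkSum, Pi.zero_apply, mul_zero, zero_mul, Finset.sum_const_zero]
    positivity
  obtain ⟨r, hr⟩ : ∃ r, t = s + 1 + r + 1 := ⟨t - 1 - (s + 1), by omega⟩
  have e1 : t - 1 - (s + 1) = r := by omega
  have e2 : t - (s + 1) = r + 1 := by omega
  have e3 : t - 2 = s + r := by omega
  have key : ∀ z w, S z w *
      (truncRatio S f g t (s + 1) w z * walkSum S f (truncRatio S f g t) (s + 1) w)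
        * heat S g (t - (s + 1)) z
      ≤ t * (heat S f s w * (heat S g r w / heat S f (s + 2) w)
          * (S w z * heat S f (s + 1) z)) := by
    intro z w
    have h1 := walkSum_truncRatio_le hS hf hg t (s + 1) w
    have h2 := truncRatio_le_edgeRatio hS hf hg t (s + 1) w z
    have h3 := edgeRatio_nonneg hS hf hg (s + 1) r w z
    have h4 := heat_nonneg hS hg (r + 1) z
    have h5 := heat_nonneg hS hf s w
    have h6 := hS z w
    have h7 := walkSum_nonneg hS hf (truncRatio_nonneg hS hf hg t) (s + 1) w
    have hst : ((s + 1 : ℕ) : ℝ) ≤ t := by exact_mod_cast hs.le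
    rw [e1] at h2
    rw [e2, hsymm.apply z w]
    simp only [Nat.add_sub_cancel] at h1
    have h8 : walkSum S f (truncRatio S f g t) (s + 1) w ≤ t * heat S f s w :=
      h1.trans (by gcongr)
    have h9 : edgeRatio S f g (s + 1) r w z * heat S g (r + 1) z
        ≤ heat S f (s + 1) z * (heat S g r w / heat S f (s + 2) w) := by
      rw [edgeRatio, mul_comm (heat S f (s + 1 + 1) w)]
      exact mul_div_mul_mul_cancel_le (heat_nonneg hS hf _ _) (heat_nonneg hS hg _ _)
        (heat_nonneg hS hf _ _)
    calc S z w * (truncRatio S f g t (s + 1) w z * walkSum S f (truncRatio S f g t) (s + 1) w)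
          * heat S g (r + 1) z
        ≤ S z w * (edgeRatio S f g (s + 1) r w z * (t * heat S f s w)) * heat S g (r + 1) z := by
          gcongr
      _ = S z w * (t * heat S f s w) * (edgeRatio S f g (s + 1) r w z * heat S g (r + 1) z) := by
          ring
      _ ≤ S z w * (t * heat S f s w)
            * (heat S f (s + 1) z * (heat S g r w / heat S f (s + 2) w)) := by
          gcongr
      _ = _ := by ring
  refine (Finset.sum_le_sum fun z _ => Finset.sum_le_sum fun w _ => key z w).trans ?_
  rw [Finset.sum_comm, e3, ← sum_heat_mul_heat hsymm, Finset.mul_sum]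
  refine Finset.sum_le_sum fun w _ => ?_
  rw [← Finset.mul_sum, ← Finset.mul_sum, ← heat_succ]
  have h1 := heat_nonneg hS hf (s + 2) w
  have h2 := heat_nonneg hS hf s w
  have h3 := heat_nonneg hS hg r w
  refine mul_le_mul_of_nonneg_left ?_ (Nat.cast_nonneg t)
  rw [mul_assoc]
  refine mul_le_mul_of_nonneg_left ?_ h2
  rcases h1.eq_or_lt with h | h
  · rw [← h]; simpa using h3
  · exact le_of_eq (div_mul_cancel₀ _ h.ne')

lemma sum_truncRatio_mul_le (hsymm : S.IsSymm) (hS : ∀ x y, 0 ≤ S x y)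
    (hf : ∀ x, 0 ≤ f x) (hg : ∀ x, 0 ≤ g x) {t s : ℕ} (hs : s < t) :
    ∑ z, ∑ w, S z w * (truncRatio S f g t s w z * heat S f (s + 1) w) * heat S g (t - s) z
      ≤ measuredHeat S f g t := by
  rw [show t = s + (t - s) by omega, ← sum_heat_mul_heat hsymm,
    show s + (t - s) = t by omega]
  refine Finset.sum_le_sum fun z _ => ?_
  rw [← Finset.sum_mul]
  exact mul_le_mul_of_nonneg_right (sum_truncRatio_mul_heat_le hS hf hg t s z)
    (heat_nonneg hS hg _ z)

lemma sum_walkSqSum_truncRatio_le (hsymm : S.IsSymm) (hS : ∀ x y, 0 ≤ S x y)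
    (hf : ∀ x, 0 ≤ f x) (hg : ∀ x, 0 ≤ g x) (t : ℕ) :
    ∑ z, walkSqSum S f (truncRatio S f g t) t z * heat S g 1 z
      ≤ t ^ 2 * (2 * measuredHeat S f g (t - 2) + measuredHeat S f g t) := by
  rw [sum_walkSqSum_mul_heat hsymm]
  have key : ∀ s ∈ Finset.range t, ∑ z, ∑ w,
      S z w * (2 * truncRatio S f g t s w z * walkSum S f (truncRatio S f g t) s w
          + truncRatio S f g t s w z ^ 2 * heat S f (s + 1) w) * heat S g (t - s) z
      ≤ t * (2 * measuredHeat S f g (t - 2) + measuredHeat S f g t) := by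
    intro s hs
    have h1 := sum_truncRatio_mul_walkSum_le hsymm hS hf hg (Finset.mem_range.1 hs)
    have h2 := sum_truncRatio_mul_le hsymm hS hf hg (Finset.mem_range.1 hs)
    calc _ ≤ ∑ z, ∑ w, (2 * (S z w *
            (truncRatio S f g t s w z * walkSum S f (truncRatio S f g t) s w)
              * heat S g (t - s) z)
          + t * (S z w * (truncRatio S f g t s w z * heat S f (s + 1) w)
              * heat S g (t - s) z)) := by
          refine Finset.sum_le_sum fun z _ => Finset.sum_le_sum fun w _ => ?_
          have h3 := truncRatio_nonneg hS hf hg t s w z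
          have h4 := truncRatio_le (S := S) (f := f) (g := g) t s w z
          have h5 := mul_nonneg (mul_nonneg (hS z w)
            (mul_nonneg h3 (heat_nonneg hS hf (s + 1) w))) (heat_nonneg hS hg (t - s) z)
          nlinarith [mul_le_mul_of_nonneg_right h4 h5]
      _ ≤ _ := by
          simp only [Finset.sum_add_distrib, ← Finset.mul_sum]
          have : (0 : ℝ) ≤ t := Nat.cast_nonneg t
          nlinarith [mul_le_mul_of_nonneg_left h2 this]
  refine (Finset.sum_le_sum key).trans (le_of_eq ?_)
  rw [Finset.sum_const, Finset.card_range, nsmul_eq_mul]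
  ring

/-- Markov's inequality for the logarithm of the ratio: its negative part is controlled by the
expectation of the inverse ratio, which is at most `m_{t+2}`. -/
lemma le_sum_walkSum_truncRatio {Z : ℝ} (hsymm : S.IsSymm) (hS : ∀ x y, 0 ≤ S x y)
    (hf : ∀ x, 0 ≤ f x) (hf1 : ∀ x, f x ≤ 1) (hg : ∀ x, 0 ≤ g x) (hg1 : ∀ x, g x ≤ 1)
    (hfZ : ∑ x, f x ≤ Z) (hgZ : ∑ x, g x ≤ Z) (hZ : 0 < Z) {t : ℕ} (ht : 0 < Real.log t)
    (ha : 0 < measuredHeat S f g t) :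
    t * measuredHeat S f g t
      - (2 * (measuredHeat S f g t * Real.log (Z / measuredHeat S f g t))
          + t * measuredHeat S f g (t + 2)) / Real.log t
      ≤ ∑ z, walkSum S f (truncRatio S f g t) t z * heat S g 1 z := by
  rw [sum_walkSum_mul_heat hsymm]
  have ht0 : (0 : ℝ) < t := by
    rcases Nat.eq_zero_or_pos t with h | h
    · simp [h] at ht
    · exact_mod_cast h
  have key : ∀ s ∈ Finset.range t, measuredHeat S f g t - ((∑ z, ∑ w,
      edgeWeight S f g s (t - 1 - s) z w * Real.log (edgeRatio S f g s (t - 1 - s) w z))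
        + measuredHeat S f g (t + 2)) / Real.log t
      ≤ ∑ z, ∑ w, S z w * (truncRatio S f g t s w z * heat S f (s + 1) w)
          * heat S g (t - s) z := by
    intro s hs
    obtain ⟨r, hr⟩ : ∃ r, t = s + r + 1 := ⟨t - 1 - s, by have := Finset.mem_range.1 hs; omega⟩
    have e1 : t - 1 - s = r := by omega
    have e2 : t - s = r + 1 := by omega
    have h1 := sum_edgeWeight_mul_inv_edgeRatio_le hsymm hS hf hg s r
    have h2 := sum_edgeWeight (f := f) (g := g) hsymm s r
    rw [← hr] at h2
    rw [show s + r + 3 = t + 2 by omega] at h1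
    rw [e1, e2]
    have hpt : ∀ z w, edgeWeight S f g s r z w
        - (edgeWeight S f g s r z w * Real.log (edgeRatio S f g s r w z)
          + edgeWeight S f g s r z w * (edgeRatio S f g s r w z)⁻¹) / Real.log t
        ≤ S z w * (truncRatio S f g t s w z * heat S f (s + 1) w) * heat S g (r + 1) z := by
      intro z w
      have hnn : 0 ≤ S z w * (truncRatio S f g t s w z * heat S f (s + 1) w)
          * heat S g (r + 1) z :=
        mul_nonneg (mul_nonneg (hS z w) (mul_nonneg (truncRatio_nonneg hS hf hg t s w z)
          (heat_nonneg hS hf _ _))) (heat_nonneg hS hg _ _)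
      by_cases h0 : edgeWeight S f g s r z w = 0
      · simpa [h0] using hnn
      obtain ⟨p1, p2, p3, p4⟩ := heat_pos_of_edgeWeight_ne_zero hsymm hS hf hg h0
      have hpos : 0 < edgeRatio S f g s r w z := by rw [edgeRatio]; positivity
      have hw := edgeWeight_nonneg hS hf hg s r z w
      rw [← mul_add, mul_div_assoc]
      by_cases hle : edgeRatio S f g s r w z ≤ t
      · have h3 : S z w * (truncRatio S f g t s w z * heat S f (s + 1) w) * heat S g (r + 1) z
            = edgeWeight S f g s r z w := by
          rw [truncRatio, e1, if_pos hle, edgeRatio, edgeWeight]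
          field_simp
        rw [h3]
        have h4 := Real.log_le_sub_one_of_pos (inv_pos.2 hpos)
        rw [Real.log_inv] at h4
        have h5 : 0 ≤ edgeWeight S f g s r z w * ((Real.log (edgeRatio S f g s r w z)
            + (edgeRatio S f g s r w z)⁻¹) / Real.log t) :=
          mul_nonneg hw (div_nonneg (by linarith) ht.le)
        linarith
      · refine le_trans ?_ hnn
        have h4 : Real.log t ≤ Real.log (edgeRatio S f g s r w z) :=
          Real.log_le_log ht0 (not_le.1 hle).le
        have h5 : 1 ≤ (Real.log (edgeRatio S f g s r w z)
            + (edgeRatio S f g s r w z)⁻¹) / Real.log t := by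
          rw [le_div_iff₀ ht]
          have := inv_pos.2 hpos
          linarith
        nlinarith
    refine le_trans ?_ (Finset.sum_le_sum fun z _ => Finset.sum_le_sum fun w _ => hpt z w)
    simp only [Finset.sum_sub_distrib, ← Finset.sum_div, Finset.sum_add_distrib, h2]
    gcongr
  refine le_trans ?_ (Finset.sum_le_sum key)
  rw [Finset.sum_sub_distrib, ← Finset.sum_div, Finset.sum_add_distrib]
  simp only [Finset.sum_const, Finset.card_range, nsmul_eq_mul]
  have := sum_edgeWeight_mul_log_edgeRatio_le hsymm hS hf hf1 hg hg1 hfZ hgZ hZ t ha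
  gcongr

/-- Truncated log-convexity of the measured heat `m_t`: as long as `m_t / Z` is not below
`t ^ (-t / 8)`, the product `m_{t+2} m_{t-2}` is at least a constant times `m_t ^ 2`, unless
`m_{t+2}` is itself at least a constant times `m_t`. -/
theorem measuredHeat_sq_le {Z : ℝ} (hsymm : S.IsSymm) (hS : ∀ x y, 0 ≤ S x y)
    (hf : ∀ x, 0 ≤ f x) (hf1 : ∀ x, f x ≤ 1) (hg : ∀ x, 0 ≤ g x) (hg1 : ∀ x, g x ≤ 1)
    (hfZ : ∑ x, f x ≤ Z) (hgZ : ∑ x, g x ≤ Z) (hZ : 0 < Z) {t : ℕ} (ht : 4 ≤ Real.log t)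
    (ha : 0 < measuredHeat S f g t)
    (hlog : 8 * Real.log (Z / measuredHeat S f g t) ≤ t * Real.log t)
    (hle : measuredHeat S f g (t + 2) ≤ measuredHeat S f g t) :
    measuredHeat S f g t ^ 2
      ≤ 4 * measuredHeat S f g (t + 2)
        * (2 * measuredHeat S f g (t - 2) + measuredHeat S f g t) := by
  have ht0 : (0 : ℝ) < t := by
    rcases Nat.eq_zero_or_pos t with h | h
    · norm_num [h] at ht
    · exact_mod_cast h
  have h1 := le_sum_walkSum_truncRatio hsymm hS hf hf1 hg hg1 hfZ hgZ hZ
    (by linarith : 0 < Real.log t) ha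
  have h2 := sum_walkSqSum_truncRatio_le hsymm hS hf hg t
  set a := measuredHeat S f g t with ha_def
  set A := ∑ z, walkSum S f (truncRatio S f g t) t z * heat S g 1 z with hA
  set Q := ∑ z, walkSqSum S f (truncRatio S f g t) t z * heat S g 1 z with hQ
  have hCS : A ^ 2 ≤ measuredHeat S f g (t + 2) * Q := by
    have h3 := sum_sq_le_sum_mul_sum (heat_nonneg hS hg 1)
      (heat_nonneg hS hf (t + 1))
      (walkSqSum_nonneg hS hf (truncRatio_nonneg hS hf hg t) t)
      (walkSum_sq_le hS hf (truncRatio_nonneg hS hf hg t) t)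
    rw [show t + 2 = 1 + (t + 1) by ring, measuredHeat_comm hsymm, ← sum_heat_mul_heat hsymm]
    simpa only [hA, hQ, mul_comm (heat S g 1 _)] using h3
  have hhalf : t * a / 2 ≤ A := by
    refine le_trans ?_ h1
    rw [le_sub_comm, div_le_iff₀ (by linarith)]
    nlinarith [mul_le_mul_of_nonneg_left hlog ha.le, mul_le_mul_of_nonneg_left hle ht0.le,
      mul_le_mul_of_nonneg_left ht (mul_pos ht0 ha).le]
  have hm := measuredHeat_nonneg hS hf hg (t + 2)
  have h4 : (t * a / 2) ^ 2 ≤ measuredHeat S f g (t + 2)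
      * (t ^ 2 * (2 * measuredHeat S f g (t - 2) + a)) :=
    (pow_le_pow_left₀ (by positivity) hhalf 2).trans (hCS.trans (by gcongr))
  have h5 : (t : ℝ) ^ 2 * a ^ 2 ≤ t ^ 2 * (4 * measuredHeat S f g (t + 2)
      * (2 * measuredHeat S f g (t - 2) + a)) := by nlinarith
  exact le_of_mul_le_mul_left h5 (by positivity)

end SecondMoment

/-! ### Matrices of small rectangle mass -/

/-- `G` has rectangle mass at most `N`: it lies in `N` times the convex hull of the products
`f x * g y` of functions with values in `[0, 1]`.  The hull is described by its supporting
half-spaces, which makes closure under averages and products immediate. -/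
def RectMass {X Y : Type*} [Fintype X] [Fintype Y] (G : X → Y → ℝ) (N : ℝ) : Prop :=
  ∀ (κ : X → Y → ℝ) (v : ℝ),
    (∀ (f : X → ℝ) (g : Y → ℝ), (∀ x, 0 ≤ f x ∧ f x ≤ 1) → (∀ y, 0 ≤ g y ∧ g y ≤ 1) →
      ∑ x, ∑ y, κ x y * (f x * g y) ≤ v) →
    ∑ x, ∑ y, κ x y * G x y ≤ N * v

namespace RectMass

variable {X Y : Type*} [Fintype X] [Fintype Y] {G H : X → Y → ℝ} {N M : ℝ}

lemma mono (hG : RectMass G N) (h : N ≤ M) : RectMass G M := by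
  intro κ v hκ
  have hv : 0 ≤ v := by
    simpa using hκ 0 0 (fun _ => by simp) (fun _ => by simp)
  exact (hG κ v hκ).trans (mul_le_mul_of_nonneg_right h hv)

lemma one : RectMass (fun (_ : X) (_ : Y) => (1 : ℝ)) 1 := by
  intro κ v hκ
  simpa using hκ 1 1 (fun _ => by simp) (fun _ => by simp)

lemma mul (hG : RectMass G N) (hH : RectMass H M) :
    RectMass (fun x y => G x y * H x y) (N * M) := by
  intro κ v hκ
  have h1 := hG (fun x y => κ x y * H x y) (M * v) fun f g hf hg => by
    have h2 := hH (fun x y => κ x y * (f x * g y)) v fun f' g' hf' hg' => by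
      have h3 := hκ (fun x => f x * f' x) (fun y => g y * g' y)
        (fun x => ⟨mul_nonneg (hf x).1 (hf' x).1, mul_le_one₀ (hf x).2 (hf' x).1 (hf' x).2⟩)
        (fun y => ⟨mul_nonneg (hg y).1 (hg' y).1, mul_le_one₀ (hg y).2 (hg' y).1 (hg' y).2⟩)
      refine le_trans (le_of_eq ?_) h3
      exact Finset.sum_congr rfl fun x _ => Finset.sum_congr rfl fun y _ => by ring
    refine le_trans (le_of_eq ?_) h2
    exact Finset.sum_congr rfl fun x _ => Finset.sum_congr rfl fun y _ => by ring
  refine le_trans (le_of_eq ?_) (h1.trans (le_of_eq (by ring)))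
  exact Finset.sum_congr rfl fun x _ => Finset.sum_congr rfl fun y _ => by ring

lemma pow (hG : RectMass G N) (j : ℕ) : RectMass (fun x y => G x y ^ j) (N ^ j) := by
  induction j with
  | zero => simpa using one
  | succ j ih => simpa only [pow_succ] using ih.mul hG

lemma mul_const (hG : RectMass G N) {c : ℝ} (hc : 0 ≤ c) :
    RectMass (fun x y => G x y * c) (N * c) := by
  intro κ v hκ
  have h := mul_le_mul_of_nonneg_right (hG κ v hκ) hc
  simp only [Finset.sum_mul] at h
  simpa only [mul_assoc, mul_comm c v] using h

lemma sum {ι : Type*} (s : Finset ι) {G : ι → X → Y → ℝ} {N : ι → ℝ}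
    (h : ∀ i ∈ s, RectMass (G i) (N i)) :
    RectMass (fun x y => ∑ i ∈ s, G i x y) (∑ i ∈ s, N i) := by
  intro κ v hκ
  have h1 : ∑ i ∈ s, ∑ x, ∑ y, κ x y * G i x y ≤ ∑ i ∈ s, N i * v :=
    Finset.sum_le_sum fun i hi => h i hi κ v hκ
  rw [← Finset.sum_mul] at h1
  refine le_trans (le_of_eq ?_) h1
  simp only [Finset.mul_sum]
  rw [Finset.sum_comm]
  refine Eq.symm ((Finset.sum_comm.trans ?_).trans Finset.sum_comm)
  exact Finset.sum_congr rfl fun x _ => Finset.sum_comm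

end RectMass

/-! ### Protocols -/

namespace Protocol

variable {X Y : Type*}

/-- A protocol that sends at most `d` bits on `A ×ˢ B` splits the part of `A ×ˢ B` with output `b`
into at most `2 ^ d` rectangles. -/
lemma sum_output_le [Fintype X] [Fintype Y] {κ : X → Y → ℝ} {v : ℝ} (hv : 0 ≤ v)
    (hκ : ∀ (f : X → ℝ) (g : Y → ℝ), (∀ x, 0 ≤ f x ∧ f x ≤ 1) → (∀ y, 0 ≤ g y ∧ g y ≤ 1) →
      ∑ x, ∑ y, κ x y * (f x * g y) ≤ v) (b : Bool) (p : Protocol X Y) (d : ℕ)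
    (A : Set X) (B : Set Y) (h : ∀ x ∈ A, ∀ y ∈ B, p.bits x y ≤ d) :
    ∑ x, ∑ y, κ x y * (A.indicator 1 x * B.indicator 1 y * if p.output x y = b then 1 else 0)
      ≤ 2 ^ d * v := by
  classical
  have hind : ∀ {Z : Type _} (C : Set Z) (z : Z), 0 ≤ C.indicator (1 : Z → ℝ) z ∧
      C.indicator (1 : Z → ℝ) z ≤ 1 := fun C z => by
    by_cases hz : z ∈ C <;> simp [hz]
  have hd : v ≤ 2 ^ d * v := le_mul_of_one_le_left hv (one_le_pow₀ (by norm_num))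
  induction p generalizing d A B with
  | aliceOutput f =>
    refine le_trans (le_of_eq ?_)
      ((hκ ((A ∩ {x | f x = b}).indicator 1) (B.indicator 1) (hind _) fun y => by
        by_cases hz : y ∈ B <;> simp [hz]).trans hd)
    refine Finset.sum_congr rfl fun x _ => Finset.sum_congr rfl fun y _ => ?_
    by_cases h1 : x ∈ A <;> by_cases h2 : f x = b <;> simp [h1, h2, output]
  | bobOutput g =>
    refine le_trans (le_of_eq ?_)
      ((hκ (A.indicator 1) ((B ∩ {y | g y = b}).indicator 1) (hind _) fun y => by
        by_cases hz : y ∈ B ∩ {y | g y = b} <;> simp [hz]).trans hd)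
    refine Finset.sum_congr rfl fun x _ => Finset.sum_congr rfl fun y _ => ?_
    by_cases h1 : y ∈ B <;> by_cases h2 : g y = b <;> simp [h1, h2, output]
  | aliceSends f p q hp hq =>
    rcases d with _ | d
    · refine le_trans (Finset.sum_nonpos fun x _ => Finset.sum_nonpos fun y _ => ?_) (hv.trans hd)
      by_cases h1 : x ∈ A
      · by_cases h2 : y ∈ B
        · have := h x h1 y h2
          simp [bits] at this
        · simp [h2]
      · simp [h1]
    have hd' : v ≤ 2 ^ d * v := le_mul_of_one_le_left hv (one_le_pow₀ (by norm_num))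
    have e1 := hq d (A ∩ {x | f x = true}) B (fun x hx y hy => by
      have h1 := h x hx.1 y hy
      have h2 : f x = true := hx.2
      simpa [bits, h2] using h1) hd'
    have e2 := hp d (A ∩ {x | f x = false}) B (fun x hx y hy => by
      have h1 := h x hx.1 y hy
      have h2 : f x = false := hx.2
      simpa [bits, h2] using h1) hd'
    rw [pow_succ, show (2 : ℝ) ^ d * 2 * v = 2 ^ d * v + 2 ^ d * v by ring]
    refine le_trans (le_of_eq ?_) (add_le_add e1 e2)
    simp only [← Finset.sum_add_distrib, ← mul_add]
    refine Finset.sum_congr rfl fun x _ => Finset.sum_congr rfl fun y _ => ?_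
    by_cases h1 : x ∈ A <;> cases h2 : f x <;> simp [h1, h2, output]
  | bobSends g p q hp hq =>
    rcases d with _ | d
    · refine le_trans (Finset.sum_nonpos fun x _ => Finset.sum_nonpos fun y _ => ?_) (hv.trans hd)
      by_cases h1 : x ∈ A
      · by_cases h2 : y ∈ B
        · have := h x h1 y h2
          simp [bits] at this
        · simp [h2]
      · simp [h1]
    have hd' : v ≤ 2 ^ d * v := le_mul_of_one_le_left hv (one_le_pow₀ (by norm_num))
    have e1 := hq d A (B ∩ {y | g y = true}) (fun x hx y hy => by
      have h1 := h x hx y hy.1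
      have h2 : g y = true := hy.2
      simpa [bits, h2] using h1) hd'
    have e2 := hp d A (B ∩ {y | g y = false}) (fun x hx y hy => by
      have h1 := h x hx y hy.1
      have h2 : g y = false := hy.2
      simpa [bits, h2] using h1) hd'
    rw [pow_succ, show (2 : ℝ) ^ d * 2 * v = 2 ^ d * v + 2 ^ d * v by ring]
    refine le_trans (le_of_eq ?_) (add_le_add e1 e2)
    simp only [← Finset.sum_add_distrib, ← mul_add]
    refine Finset.sum_congr rfl fun x _ => Finset.sum_congr rfl fun y _ => ?_
    by_cases h1 : y ∈ B <;> cases h2 : g y <;> simp [h1, h2, output]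

/-- Without communication the output depends on one of the two inputs only. -/
lemma exists_output_eq_of_bits_eq_zero [Nonempty X] [Nonempty Y] (p : Protocol X Y)
    (h : ∀ x y, p.bits x y = 0) :
    (∃ f : X → Bool, ∀ x y, p.output x y = f x) ∨ ∃ g : Y → Bool, ∀ x y, p.output x y = g y := by
  cases p with
  | aliceOutput f => exact Or.inl ⟨f, fun _ _ => rfl⟩
  | bobOutput g => exact Or.inr ⟨g, fun _ _ => rfl⟩
  | aliceSends f p q => simpa [bits] using h (Classical.arbitrary X) (Classical.arbitrary Y)
  | bobSends g p q => simpa [bits] using h (Classical.arbitrary X) (Classical.arbitrary Y)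

end Protocol

namespace RandomizedProtocol

variable {X Y Ω : Type*} [MeasurableSpace Ω]

lemma bits_le_of_cost_le {P : RandomizedProtocol X Y Ω} {d : ℕ} (h : P.cost ≤ d) (ω : Ω) (x : X)
    (y : Y) : (P.run ω).bits x y ≤ d := by
  have h1 : ((P.run ω).bits x y : ℕ∞) ≤ d := by
    refine le_trans ?_ h
    exact le_iSup_of_le ω (le_iSup_of_le x (le_iSup_of_le y le_rfl))
  exact_mod_cast h1

lemma measurableSet_output (P : RandomizedProtocol X Y Ω) (x : X) (y : Y) (b : Bool) :
    MeasurableSet {ω | (P.run ω).output x y = b} :=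
  P.measurable_output x y (MeasurableSet.singleton b)

/-- The weighted sum of output probabilities is the expected weighted sum of outputs. -/
lemma sum_mul_measureReal_output [Fintype X] [Fintype Y] (P : RandomizedProtocol X Y Ω)
    (μ : Measure Ω) [IsProbabilityMeasure μ] (κ : X → Y → ℝ) (b : Bool) :
    ∑ x, ∑ y, κ x y * μ.real {ω | (P.run ω).output x y = b}
      = ∫ ω, ∑ x, ∑ y, κ x y * (if (P.run ω).output x y = b then 1 else 0) ∂μ := by
  have hind : ∀ x y, (fun ω => if (P.run ω).output x y = b then (1 : ℝ) else 0)
      = {ω | (P.run ω).output x y = b}.indicator 1 := by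
    intro x y
    ext ω
    simp [Set.indicator]
  have hint : ∀ x y, Integrable
      (fun ω => κ x y * (if (P.run ω).output x y = b then (1 : ℝ) else 0)) μ := by
    intro x y
    refine Integrable.const_mul ?_ _
    rw [hind]
    exact (integrable_const (μ := μ) (1 : ℝ)).indicator (P.measurableSet_output x y b)
  rw [integral_finsetSum _ fun x _ => integrable_finsetSum _ fun y _ => hint x y]
  refine Finset.sum_congr rfl fun x _ => ?_
  rw [integral_finsetSum _ fun y _ => hint x y]
  refine Finset.sum_congr rfl fun y _ => ?_
  rw [integral_const_mul, hind]
  congr 1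
  exact (integral_indicator_one (P.measurableSet_output x y b)).symm

lemma rectMass_measureReal_output [Fintype X] [Fintype Y] (P : RandomizedProtocol X Y Ω)
    (μ : Measure Ω) [IsProbabilityMeasure μ] {d : ℕ} (h : P.cost ≤ d) (b : Bool) :
    RectMass (fun x y => μ.real {ω | (P.run ω).output x y = b}) (2 ^ d) := by
  intro κ v hκ
  have hv : 0 ≤ v := by simpa using hκ 0 0 (fun _ => by simp) (fun _ => by simp)
  rw [P.sum_mul_measureReal_output]
  have hle : ∀ ω, ∑ x, ∑ y, κ x y * (if (P.run ω).output x y = b then 1 else 0) ≤ 2 ^ d * v := by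
    intro ω
    have := (P.run ω).sum_output_le hv hκ b d Set.univ Set.univ
      fun x _ y _ => P.bits_le_of_cost_le h ω x y
    simpa using this
  by_cases hi : Integrable
      (fun ω => ∑ x, ∑ y, κ x y * (if (P.run ω).output x y = b then (1 : ℝ) else 0)) μ
  · refine (integral_mono hi (integrable_const (2 ^ d * v)) hle).trans ?_
    simp
  · rw [integral_undef hi]
    positivity

lemma measureReal_output_false (P : RandomizedProtocol X Y Ω) (μ : Measure Ω)
    [IsProbabilityMeasure μ] (x : X) (y : Y) :
    μ.real {ω | (P.run ω).output x y = false}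
      = 1 - μ.real {ω | (P.run ω).output x y = true} := by
  rw [← probReal_compl_eq_one_sub (P.measurableSet_output x y true)]
  congr 1
  ext ω
  simp

end RandomizedProtocol

/-! ### Amplification by majority vote -/

/-- The probability of at least `m` successes in `2 * m` independent trials that succeed with
probability `p`. -/
def majority (m : ℕ) (p : ℝ) : ℝ :=
  ∑ j ∈ Finset.Ico m (2 * m + 1), p ^ j * (1 - p) ^ (2 * m - j) * (2 * m).choose j

lemma sum_majority_add (m : ℕ) (p : ℝ) :
    ∑ j ∈ Finset.range m, p ^ j * (1 - p) ^ (2 * m - j) * (2 * m).choose j + majority m p = 1 := by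
  rw [majority, Finset.sum_range_add_sum_Ico _ (by omega), ← add_pow]
  simp

lemma majority_nonneg (m : ℕ) {p : ℝ} (h0 : 0 ≤ p) (h1 : p ≤ 1) : 0 ≤ majority m p := by
  have := sub_nonneg.2 h1
  exact Finset.sum_nonneg fun j _ => by positivity

lemma majority_le_one (m : ℕ) {p : ℝ} (h0 : 0 ≤ p) (h1 : p ≤ 1) : majority m p ≤ 1 := by
  rw [← sum_majority_add m p]
  have := sub_nonneg.2 h1
  have : 0 ≤ ∑ j ∈ Finset.range m, p ^ j * (1 - p) ^ (2 * m - j) * ((2 * m).choose j : ℝ) :=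
    Finset.sum_nonneg fun j _ => by positivity
  linarith

/-- If the less likely outcome occurs at least half of the time in `2 * m` trials, a factor
`(p * (1 - p)) ^ m` can be split off; the binomial coefficients sum to `4 ^ m`. -/
lemma sum_choose_le {m : ℕ} {s : Finset ℕ} {p δ : ℝ} (hs : s ⊆ Finset.range (2 * m + 1))
    (h0 : 0 ≤ p) (h1 : p ≤ 1) (hp : p * (1 - p) ≤ δ * (1 - δ))
    (h : ∀ j ∈ s, p ^ j * (1 - p) ^ (2 * m - j) ≤ (p * (1 - p)) ^ m) :
    ∑ j ∈ s, p ^ j * (1 - p) ^ (2 * m - j) * (2 * m).choose j ≤ (4 * (δ * (1 - δ))) ^ m := by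
  have hq := sub_nonneg.2 h1
  calc _ ≤ ∑ j ∈ s, (δ * (1 - δ)) ^ m * ((2 * m).choose j : ℝ) := by
        refine Finset.sum_le_sum fun j hj => ?_
        refine mul_le_mul_of_nonneg_right ((h j hj).trans ?_) (Nat.cast_nonneg _)
        exact pow_le_pow_left₀ (by positivity) hp m
    _ ≤ ∑ j ∈ Finset.range (2 * m + 1), (δ * (1 - δ)) ^ m * ((2 * m).choose j : ℝ) := by
        have : 0 ≤ δ * (1 - δ) := le_trans (by positivity) hp
        exact Finset.sum_le_sum_of_subset_of_nonneg hs fun j _ _ => by positivity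
    _ = _ := by
        rw [← Finset.mul_sum, mul_pow 4, mul_comm]
        congr 1
        have := Nat.sum_range_choose (2 * m)
        rw [pow_mul] at this
        exact_mod_cast this

lemma majority_le {m : ℕ} {p δ : ℝ} (h0 : 0 ≤ p) (hp : p ≤ δ) (hδ : δ ≤ 1 / 2) :
    majority m p ≤ (4 * (δ * (1 - δ))) ^ m := by
  refine sum_choose_le (fun j hj => ?_) h0 (by linarith) (by nlinarith) fun j hj => ?_
  · exact Finset.mem_range.2 (Finset.mem_Ico.1 hj).2
  · obtain ⟨i, rfl⟩ := Nat.exists_eq_add_of_le (Finset.mem_Ico.1 hj).1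
    obtain ⟨l, hl⟩ := Nat.exists_eq_add_of_le (Nat.lt_succ_iff.1 (Finset.mem_Ico.1 hj).2)
    have e : m = i + l := by omega
    have hq : 0 ≤ 1 - p := by linarith
    rw [show 2 * m - (m + i) = l by omega, mul_pow, pow_add, mul_assoc]
    refine mul_le_mul_of_nonneg_left ?_ (by positivity)
    conv_rhs => rw [e, pow_add]
    gcongr
    linarith

lemma one_sub_majority_le {m : ℕ} {p δ : ℝ} (h1 : p ≤ 1) (hp : 1 - δ ≤ p) (hδ : δ ≤ 1 / 2) :
    1 - majority m p ≤ (4 * (δ * (1 - δ))) ^ m := by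
  rw [sub_eq_iff_eq_add.2 (sum_majority_add m p).symm]
  have h0 : 0 ≤ p := by linarith
  refine sum_choose_le (fun j hj => ?_) h0 h1 (by nlinarith) fun j hj => ?_
  · have := Finset.mem_range.1 hj
    exact Finset.mem_range.2 (by omega)
  · obtain ⟨i, hi⟩ := Nat.exists_eq_add_of_lt (Finset.mem_range.1 hj)
    have hq : 0 ≤ 1 - p := by linarith
    rw [show 2 * m - j = m + (i + 1) by omega, mul_pow, pow_add, mul_left_comm,
      mul_comm (p ^ m)]
    refine mul_le_mul_of_nonneg_left ?_ (by positivity)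
    conv_rhs => rw [show m = j + (i + 1) by omega, pow_add]
    gcongr
    linarith

lemma RectMass.majority {X Y : Type*} [Fintype X] [Fintype Y] {G : X → Y → ℝ} {N : ℝ}
    (hG : RectMass G N) (hG' : RectMass (fun x y => 1 - G x y) N) (hN : 0 ≤ N) (m : ℕ) :
    RectMass (fun x y => majority m (G x y)) ((2 * N) ^ (2 * m)) := by
  have h := RectMass.sum (Finset.Ico m (2 * m + 1)) fun j _ =>
    ((hG.pow j).mul (hG'.pow (2 * m - j))).mul_const (Nat.cast_nonneg ((2 * m).choose j))
  refine h.mono ?_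
  calc ∑ j ∈ Finset.Ico m (2 * m + 1), N ^ j * N ^ (2 * m - j) * ((2 * m).choose j : ℝ)
      = ∑ j ∈ Finset.Ico m (2 * m + 1), N ^ (2 * m) * ((2 * m).choose j : ℝ) := by
        refine Finset.sum_congr rfl fun j hj => ?_
        rw [← pow_add]
        congr 2
        have := Finset.mem_Ico.1 hj
        omega
    _ ≤ ∑ j ∈ Finset.range (2 * m + 1), N ^ (2 * m) * ((2 * m).choose j : ℝ) := by
        refine Finset.sum_le_sum_of_subset_of_nonneg (fun j hj => ?_) fun j _ _ => by positivity
        exact Finset.mem_range.2 (Finset.mem_Ico.1 hj).2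
    _ = _ := by
        rw [← Finset.mul_sum, mul_pow, mul_comm]
        congr 1
        exact_mod_cast Nat.sum_range_choose (2 * m)

/-! ### Rectangle mass of a matrix that separates two walk lengths -/

section WalkMean

variable {V : Type*} [Fintype V] [DecidableEq V]

/-- The mean of `G x (σ y)`, where `x` is uniform and `y` is reached from `x` by `t` steps of the
walk with transition matrix `S`. -/
noncomputable def walkMean (S : Matrix V V ℝ) (σ : V → V) (t : ℕ) (G : V → V → ℝ) : ℝ :=
  (Fintype.card V : ℝ)⁻¹ * ∑ x, ∑ y, (S ^ t) x y * G x (σ y)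

variable {S : Matrix V V ℝ} {σ : V → V} {G : V → V → ℝ}

lemma walkMean_eq_sum (hσ : Function.Involutive σ) (t : ℕ) :
    walkMean S σ t G
      = ∑ x, ∑ y, (Fintype.card V : ℝ)⁻¹ * (S ^ t) x (σ y) * G x y := by
  rw [walkMean, Finset.mul_sum]
  refine Finset.sum_congr rfl fun x _ => ?_
  rw [Finset.mul_sum, ← Equiv.sum_comp hσ.toPerm]
  refine Finset.sum_congr rfl fun y _ => ?_
  simp only [Function.Involutive.coe_toPerm, hσ y, mul_assoc]

lemma walkMean_mul (f g : V → ℝ) (t : ℕ) :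
    walkMean S σ t (fun x y => f x * g y)
      = (Fintype.card V : ℝ)⁻¹ * measuredHeat S f (g ∘ σ) t := by
  rw [walkMean, measuredHeat]
  congr 1
  refine Finset.sum_congr rfl fun x _ => ?_
  simp only [heat, Matrix.mulVec, dotProduct, Finset.mul_sum, Function.comp]
  exact Finset.sum_congr rfl fun y _ => by ring

lemma pow_apply_nonneg (hS : ∀ x y, 0 ≤ S x y) (t : ℕ) (x y : V) : 0 ≤ (S ^ t) x y := by
  induction t generalizing y with
  | zero => simp only [pow_zero, Matrix.one_apply]; split_ifs <;> norm_num
  | succ t ih =>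
    rw [pow_succ, Matrix.mul_apply]
    exact Finset.sum_nonneg fun w _ => mul_nonneg (ih w) (hS _ _)

lemma sum_pow_apply (hS : ∀ x, ∑ y, S x y = 1) (t : ℕ) (x : V) : ∑ y, (S ^ t) x y = 1 := by
  induction t with
  | zero => simp [Matrix.one_apply]
  | succ t ih =>
    simp only [pow_succ, Matrix.mul_apply]
    rw [Finset.sum_comm]
    simp only [← Finset.mul_sum, hS, mul_one, ih]

lemma walkMean_const [Nonempty V] (hS : ∀ x, ∑ y, S x y = 1) (t : ℕ) (c : ℝ) :
    walkMean S σ t (fun _ _ => c) = c := by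
  simp only [walkMean, ← Finset.sum_mul, sum_pow_apply hS, Finset.sum_const, Finset.card_univ,
    nsmul_eq_mul, mul_one]
  rw [← mul_assoc, inv_mul_cancel₀ (by simp), one_mul]

lemma walkMean_mono (hS : ∀ x y, 0 ≤ S x y) {H : V → V → ℝ} (h : ∀ x y, G x y ≤ H x y) (t : ℕ) :
    walkMean S σ t G ≤ walkMean S σ t H := by
  refine mul_le_mul_of_nonneg_left ?_ (by positivity)
  exact Finset.sum_le_sum fun x _ => Finset.sum_le_sum fun y _ =>
    mul_le_mul_of_nonneg_left (h _ _) (pow_apply_nonneg hS t x y)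

/-- If `G` has a large mean over walks of length `k` and mean at most `η` over those of length
`k + 2`, then some rectangle of measure at least a constant over `N` at time `k` loses a factor of
`8 * η` at time `k + 2`, which `measuredHeat_mul_exp_le` limits. -/
theorem le_rectMass_mul_exp_log [Nonempty V] (hsymm : S.IsSymm) (hS : ∀ x y, 0 ≤ S x y)
    (hσ : Function.Involutive σ) {N η : ℝ} (hG : RectMass G N) {k : ℕ} (hk : 0 < k) (hη : 0 < η)
    (h1 : 7 / 8 ≤ walkMean S σ k G) (h2 : walkMean S σ (k + 2) G ≤ η) :
    3 / 4 ≤ N * Real.exp (k / 2 * Real.log (8 * η)) := by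
  have hV : (0 : ℝ) < Fintype.card V := by exact_mod_cast Fintype.card_pos
  set κ : V → V → ℝ := fun x y => (Fintype.card V : ℝ)⁻¹ * (S ^ k) x (σ y)
    - (8 * η)⁻¹ * ((Fintype.card V : ℝ)⁻¹ * (S ^ (k + 2)) x (σ y)) with hκ
  have hlin : ∀ H : V → V → ℝ, ∑ x, ∑ y, κ x y * H x y
      = walkMean S σ k H - (8 * η)⁻¹ * walkMean S σ (k + 2) H := by
    intro H
    simp only [hκ, walkMean_eq_sum hσ, sub_mul, Finset.sum_sub_distrib, Finset.mul_sum, mul_assoc]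
  have hrect := hG κ (Real.exp (k / 2 * Real.log (8 * η))) fun f g hf hg => by
    rw [hlin fun x y => f x * g y, walkMean_mul, walkMean_mul]
    have hg' : ∀ x, 0 ≤ (g ∘ σ) x ∧ (g ∘ σ) x ≤ 1 := fun x => hg (σ x)
    have hsum : ∀ u : V → ℝ, (∀ x, 0 ≤ u x ∧ u x ≤ 1) → ∑ x, u x ≤ Fintype.card V :=
      fun u hu => (Finset.sum_le_sum fun x _ => (hu x).2).trans (by simp)
    have hm := measuredHeat_nonneg hS (fun x => (hf x).1) (fun x => (hg' x).1) (k + 2)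
    have hm0 := measuredHeat_nonneg hS (fun x => (hf x).1) (fun x => (hg' x).1) k
    set a := measuredHeat S f (g ∘ σ) k with ha
    by_contra! hcon
    have hexp := Real.exp_pos (k / 2 * Real.log (8 * η))
    have hpos : 0 < a := by
      rcases hm0.eq_or_lt with h | h
      · rw [← h] at hcon
        have : 0 ≤ (8 * η)⁻¹ * ((Fintype.card V : ℝ)⁻¹ * measuredHeat S f (g ∘ σ) (k + 2)) := by
          positivity
        linarith
      · exact h
    have hcore := measuredHeat_mul_exp_le hsymm hS (fun x => (hf x).1) (fun x => (hf x).2)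
      (fun x => (hg' x).1) (fun x => (hg' x).2) (hsum f hf) (hsum _ hg') hV hk hpos
    rw [← ha] at hcore
    have h3 : a * Real.exp (-(2 / k * Real.log (Fintype.card V / a))) < a * (8 * η) := by
      refine hcore.trans_lt ?_
      have h4 : (8 * η)⁻¹ * ((Fintype.card V : ℝ)⁻¹ * measuredHeat S f (g ∘ σ) (k + 2))
          < (Fintype.card V : ℝ)⁻¹ * a := by linarith
      rw [mul_left_comm] at h4
      have h5 := lt_of_mul_lt_mul_left h4 (by positivity)
      rw [inv_mul_lt_iff₀ (by positivity)] at h5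
      linarith
    have h4 := lt_of_mul_lt_mul_left h3 hpos.le
    rw [← Real.lt_log_iff_exp_lt (by positivity)] at h4
    have hk' : (0 : ℝ) < k := by exact_mod_cast hk
    have h5 : Real.log ((Fintype.card V : ℝ)⁻¹ * a) < k / 2 * Real.log (8 * η) := by
      have e : Real.log ((Fintype.card V : ℝ)⁻¹ * a) = - Real.log (Fintype.card V / a) := by
        rw [← Real.log_inv, inv_div, div_eq_inv_mul]
      rw [e]
      have h6 := mul_lt_mul_of_pos_left h4 (by positivity : (0 : ℝ) < k / 2)
      have h7 : (k : ℝ) / 2 * -(2 / k * Real.log (Fintype.card V / a))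
          = - Real.log (Fintype.card V / a) := by field_simp
      linarith
    rw [Real.log_lt_iff_lt_exp (by positivity)] at h5
    have : 0 ≤ (8 * η)⁻¹ * ((Fintype.card V : ℝ)⁻¹ * measuredHeat S f (g ∘ σ) (k + 2)) := by
      positivity
    linarith
  refine le_trans ?_ hrect
  rw [hlin]
  have h3 := mul_le_mul_of_nonneg_left h2 (by positivity : 0 ≤ (8 * η)⁻¹)
  have h4 : (8 * η)⁻¹ * η = 1 / 8 := by field_simp
  linarith

/-- The analogue of `le_rectMass_mul_exp_log` with `measuredHeat_sq_le`.  The heat at time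
`k - 2` is controlled because `G` is at most one. -/
theorem le_rectMass_mul_exp_mul_log [Nonempty V] (hsymm : S.IsSymm) (hS : ∀ x y, 0 ≤ S x y)
    (hS1 : ∀ x, ∑ y, S x y = 1) (hσ : Function.Involutive σ) {N η : ℝ} (hG : RectMass G N)
    (hG1 : ∀ x y, G x y ≤ 1) {k : ℕ} (hk : 4 ≤ Real.log k) (hη : 0 < η) (hη' : η ≤ 1 / 320)
    (h1 : 7 / 8 ≤ walkMean S σ k G) (h2 : walkMean S σ (k + 2) G ≤ η) :
    1 / 2 ≤ N * Real.exp (-(k * Real.log k / 8)) := by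
  have hV : (0 : ℝ) < Fintype.card V := by exact_mod_cast Fintype.card_pos
  set κ : V → V → ℝ := fun x y => (Fintype.card V : ℝ)⁻¹ * (S ^ k) x (σ y)
    - 1 / 4 * ((Fintype.card V : ℝ)⁻¹ * (S ^ (k - 2)) x (σ y))
    - (8 * η)⁻¹ * ((Fintype.card V : ℝ)⁻¹ * (S ^ (k + 2)) x (σ y)) with hκ
  have hlin : ∀ H : V → V → ℝ, ∑ x, ∑ y, κ x y * H x y
      = walkMean S σ k H - 1 / 4 * walkMean S σ (k - 2) H
        - (8 * η)⁻¹ * walkMean S σ (k + 2) H := by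
    intro H
    simp only [hκ, walkMean_eq_sum hσ, sub_mul, Finset.sum_sub_distrib, Finset.mul_sum, mul_assoc]
  have hrect := hG κ (Real.exp (-(k * Real.log k / 8))) fun f g hf hg => by
    rw [hlin fun x y => f x * g y, walkMean_mul, walkMean_mul, walkMean_mul]
    have hg' : ∀ x, 0 ≤ (g ∘ σ) x ∧ (g ∘ σ) x ≤ 1 := fun x => hg (σ x)
    have hsum : ∀ u : V → ℝ, (∀ x, 0 ≤ u x ∧ u x ≤ 1) → ∑ x, u x ≤ Fintype.card V :=
      fun u hu => (Finset.sum_le_sum fun x _ => (hu x).2).trans (by simp)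
    have hm := measuredHeat_nonneg hS (fun x => (hf x).1) (fun x => (hg' x).1)
    by_contra! hcon
    have hexp := Real.exp_pos (-(k * Real.log k / 8))
    have hlow := hm (k - 2)
    have hup := hm (k + 2)
    have hmid := hm k
    set a := measuredHeat S f (g ∘ σ) k with ha
    set b := measuredHeat S f (g ∘ σ) (k - 2) with hb
    set c := measuredHeat S f (g ∘ σ) (k + 2) with hc
    have hc0 : 0 ≤ (8 * η)⁻¹ * ((Fintype.card V : ℝ)⁻¹ * c) := by positivity
    have hb0 : 0 ≤ 1 / 4 * ((Fintype.card V : ℝ)⁻¹ * b) := by positivity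
    have hae : Real.exp (-(k * Real.log k / 8)) < (Fintype.card V : ℝ)⁻¹ * a := by linarith
    have hpos : 0 < a := by
      rcases hmid.eq_or_lt with h | h
      · rw [← h, mul_zero] at hae; linarith
      · exact h
    have hb4 : b ≤ 4 * a := by
      have h4 : (Fintype.card V : ℝ)⁻¹ * b ≤ (Fintype.card V : ℝ)⁻¹ * (4 * a) := by linarith
      exact le_of_mul_le_mul_left h4 (by positivity)
    have hca : c ≤ a / 40 := by
      have h4 : (8 * η)⁻¹ * ((Fintype.card V : ℝ)⁻¹ * c) ≤ (Fintype.card V : ℝ)⁻¹ * a := by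
        linarith
      rw [mul_left_comm] at h4
      have h5 := le_of_mul_le_mul_left h4 (by positivity)
      rw [inv_mul_le_iff₀ (by positivity)] at h5
      nlinarith
    have hlog : 8 * Real.log (Fintype.card V / a) ≤ k * Real.log k := by
      rw [← Real.lt_log_iff_exp_lt (by positivity)] at hae
      have e : Real.log ((Fintype.card V : ℝ)⁻¹ * a) = - Real.log (Fintype.card V / a) := by
        rw [← Real.log_inv, inv_div, div_eq_inv_mul]
      rw [e] at hae
      linarith
    have hcore := measuredHeat_sq_le hsymm hS (fun x => (hf x).1) (fun x => (hf x).2)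
      (fun x => (hg' x).1) (fun x => (hg' x).2) (hsum f hf) (hsum _ hg') hV hk hpos hlog
      (by linarith)
    rw [← ha, ← hb, ← hc] at hcore
    have h6 : 4 * c * (2 * b + a) ≤ 4 * (a / 40) * (2 * (4 * a) + a) := by gcongr
    nlinarith
  refine le_trans ?_ hrect
  rw [hlin]
  have h3 := mul_le_mul_of_nonneg_left h2 (by positivity : 0 ≤ (8 * η)⁻¹)
  have h4 : (8 * η)⁻¹ * η = 1 / 8 := by field_simp
  have h5 := walkMean_mono (σ := σ) hS hG1 (k - 2)
  rw [walkMean_const hS1] at h5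
  linarith

end WalkMean

/-! ### The walk on the cube -/

section Cube

variable {ι : Type*} [DecidableEq ι]

/-- The string `x` with its bits in `U` flipped. -/
def flipBits (U : Finset ι) (x : ι → Bool) : ι → Bool := fun i => xor (x i) (decide (i ∈ U))

/-- The transition matrix of the walk that flips a uniformly random bit with index in `T`. -/
noncomputable def flipWalk [Fintype ι] (T : Finset ι) : Matrix (ι → Bool) (ι → Bool) ℝ :=
  fun x y => (T.card : ℝ)⁻¹ * ∑ i ∈ T, if flipBits {i} x = y then 1 else 0

variable {T U : Finset ι}

lemma flipBits_involutive (U : Finset ι) : Function.Involutive (flipBits U) := fun x => by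
  ext i
  simp [flipBits]

lemma flipBits_flipBits (h : Disjoint T U) (x : ι → Bool) :
    flipBits T (flipBits U x) = flipBits (T ∪ U) x := by
  ext i
  have : ¬ (i ∈ T ∧ i ∈ U) := fun hi => Finset.disjoint_left.1 h hi.1 hi.2
  by_cases h1 : i ∈ T <;> by_cases h2 : i ∈ U <;> simp_all [flipBits]

variable [Fintype ι]

lemma hammingDist_flipBits (U : Finset ι) (x : ι → Bool) :
    hammingDist x (flipBits U x) = U.card := by
  rw [hammingDist]
  congr 1
  ext i
  rw [Finset.mem_filter]
  by_cases h : i ∈ U <;> simp [flipBits, h]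

lemma flipWalk_isSymm (T : Finset ι) : (flipWalk T).IsSymm := by
  ext x y
  have : ∀ i, flipBits {i} y = x ↔ flipBits {i} x = y := fun i =>
    ⟨fun h => h ▸ flipBits_involutive {i} y, fun h => h ▸ flipBits_involutive {i} x⟩
  simp only [Matrix.transpose_apply, flipWalk, this]

lemma flipWalk_nonneg (T : Finset ι) (x y : ι → Bool) : 0 ≤ flipWalk T x y :=
  mul_nonneg (by positivity) (Finset.sum_nonneg fun i _ => by split_ifs <;> norm_num)

lemma sum_flipWalk_mul (x : ι → Bool) (h : (ι → Bool) → ℝ) :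
    ∑ y, flipWalk T x y * h y = (T.card : ℝ)⁻¹ * ∑ i ∈ T, h (flipBits {i} x) := by
  simp only [flipWalk, mul_assoc, ← Finset.mul_sum, Finset.sum_mul]
  rw [Finset.sum_comm]
  simp

lemma sum_flipWalk (hT : T.Nonempty) (x : ι → Bool) : ∑ y, flipWalk T x y = 1 := by
  have h := sum_flipWalk_mul (T := T) x fun _ => 1
  have hc : (T.card : ℝ) ≠ 0 := by exact_mod_cast hT.card_ne_zero
  simpa [hc] using h

open scoped Classical in
/-- The walk repeats a bit within `t` steps with probability at most `t ^ 2 / T.card`. -/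
lemma sum_flipWalk_pow_le (hT : T.Nonempty) (t : ℕ) (x : ι → Bool) :
    ∑ y, (flipWalk T ^ t) x y * (if ∃ D ⊆ T, D.card = t ∧ flipBits D x = y then 0 else 1)
      ≤ t ^ 2 / T.card := by
  have hc : (0 : ℝ) < T.card := by exact_mod_cast hT.card_pos
  induction t with
  | zero =>
    refine le_of_eq ?_
    simp only [Finset.card_eq_zero, pow_zero, Matrix.one_apply]
    rw [Finset.sum_eq_zero]
    · simp
    intro y _
    by_cases h : x = y
    · rw [if_pos (⟨∅, by simp, rfl, by ext i; simp [flipBits, h]⟩ :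
        ∃ D ⊆ T, D = ∅ ∧ flipBits D x = y), mul_zero]
    · simp [h]
  | succ t ih =>
    have hstep : ∀ w, ∑ y, flipWalk T w y *
        (if ∃ D ⊆ T, D.card = t + 1 ∧ flipBits D x = y then (0 : ℝ) else 1)
        ≤ (if ∃ D ⊆ T, D.card = t ∧ flipBits D x = w then 0 else 1) + t / T.card := by
      intro w
      have hone : ∀ y, (if ∃ D ⊆ T, D.card = t + 1 ∧ flipBits D x = y then (0 : ℝ) else 1) ≤ 1 :=
        fun y => by split_ifs <;> norm_num
      by_cases hw : ∃ D ⊆ T, D.card = t ∧ flipBits D x = w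
      · rw [if_pos hw, zero_add, sum_flipWalk_mul]
        obtain ⟨D, hDT, hDc, rfl⟩ := hw
        rw [inv_mul_le_iff₀ hc, mul_div_cancel₀ _ hc.ne', ← hDc]
        have h1 : ∀ i ∈ T, (if ∃ D' ⊆ T, D'.card = D.card + 1 ∧
            flipBits D' x = flipBits {i} (flipBits D x) then (0 : ℝ) else 1)
            ≤ if i ∈ D then 1 else 0 := by
          intro i hi
          by_cases hiD : i ∈ D
          · rw [if_pos hiD]
            split_ifs <;> norm_num
          · rw [if_neg hiD, if_pos]
            refine ⟨insert i D, Finset.insert_subset hi hDT, Finset.card_insert_of_notMem hiD, ?_⟩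
            rw [flipBits_flipBits (Finset.disjoint_singleton_left.2 hiD)]
            rfl
        refine (Finset.sum_le_sum h1).trans (le_of_eq ?_)
        rw [Finset.sum_ite_mem, Finset.inter_eq_right.2 hDT]
        simp
      · rw [if_neg hw]
        have h1 := Finset.sum_le_sum fun y (_ : y ∈ Finset.univ) =>
          mul_le_mul_of_nonneg_left (hone y) (flipWalk_nonneg T w y)
        simp only [mul_one, sum_flipWalk hT] at h1
        have : (0 : ℝ) ≤ t / T.card := by positivity
        linarith
    calc ∑ y, (flipWalk T ^ (t + 1)) x y *
          (if ∃ D ⊆ T, D.card = t + 1 ∧ flipBits D x = y then (0 : ℝ) else 1)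
        = ∑ w, (flipWalk T ^ t) x w * ∑ y, flipWalk T w y *
          (if ∃ D ⊆ T, D.card = t + 1 ∧ flipBits D x = y then (0 : ℝ) else 1) := by
          simp only [pow_succ, Matrix.mul_apply, Finset.sum_mul, Finset.mul_sum, mul_assoc]
          rw [Finset.sum_comm]
      _ ≤ ∑ w, (flipWalk T ^ t) x w *
          ((if ∃ D ⊆ T, D.card = t ∧ flipBits D x = w then 0 else 1) + t / T.card) :=
          Finset.sum_le_sum fun w _ => mul_le_mul_of_nonneg_left (hstep w)
            (pow_apply_nonneg (flipWalk_nonneg T) t x w)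
      _ ≤ t ^ 2 / T.card + t / T.card := by
          simp only [mul_add, Finset.sum_add_distrib, ← Finset.sum_mul,
            sum_pow_apply (sum_flipWalk hT), one_mul]
          linarith
      _ ≤ _ := by
          rw [← add_div]
          push_cast
          gcongr
          nlinarith [(Nat.cast_nonneg t : (0 : ℝ) ≤ t)]

/-- Flipping the bits in `U` pads the distances: after `t` steps on the other bits the distance is
`t + U.card` unless the walk repeats a bit. -/
lemma walkMean_flipWalk_le (hT : T.Nonempty) (hTU : Disjoint T U)
    {G : (ι → Bool) → (ι → Bool) → ℝ} (hG1 : ∀ x y, G x y ≤ 1) {ε : ℝ} (hε : 0 ≤ ε) {t : ℕ}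
    (h : ∀ x y, hammingDist x y = t + U.card → G x y ≤ ε) :
    walkMean (flipWalk T) (flipBits U) t G ≤ ε + t ^ 2 / T.card := by
  classical
  have key : ∀ x, ∑ y, (flipWalk T ^ t) x y * G x (flipBits U y) ≤ ε + t ^ 2 / T.card := by
    intro x
    have h1 : ∀ y, G x (flipBits U y)
        ≤ ε + if ∃ D ⊆ T, D.card = t ∧ flipBits D x = y then 0 else 1 := by
      intro y
      split_ifs with hy
      · obtain ⟨D, hDT, hDc, rfl⟩ := hy
        have hd : Disjoint U D := (Finset.disjoint_of_subset_left hDT hTU).symm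
        rw [add_zero]
        refine h _ _ ?_
        rw [flipBits_flipBits hd, hammingDist_flipBits, Finset.card_union_of_disjoint hd, hDc,
          add_comm]
      · linarith [hG1 x (flipBits U y)]
    refine (Finset.sum_le_sum fun y _ => mul_le_mul_of_nonneg_left (h1 y)
      (pow_apply_nonneg (flipWalk_nonneg T) t x y)).trans ?_
    simp only [mul_add, Finset.sum_add_distrib, ← Finset.sum_mul,
      sum_pow_apply (sum_flipWalk hT), one_mul]
    have := sum_flipWalk_pow_le hT t x
    linarith
  rw [walkMean, inv_mul_le_iff₀ (by exact_mod_cast Fintype.card_pos)]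
  refine (Finset.sum_le_sum fun x _ => key x).trans (le_of_eq ?_)
  rw [Finset.sum_const, Finset.card_univ, nsmul_eq_mul]

lemma le_walkMean_flipWalk (hT : T.Nonempty) (hTU : Disjoint T U)
    {G : (ι → Bool) → (ι → Bool) → ℝ} (hG0 : ∀ x y, 0 ≤ G x y) {ε : ℝ} (hε : 0 ≤ ε) {t : ℕ}
    (h : ∀ x y, hammingDist x y = t + U.card → 1 - ε ≤ G x y) :
    1 - (ε + t ^ 2 / T.card) ≤ walkMean (flipWalk T) (flipBits U) t G := by
  have h1 := walkMean_flipWalk_le hT hTU (G := fun x y => 1 - G x y)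
    (fun x y => by linarith [hG0 x y]) hε (t := t) fun x y hxy => by linarith [h x y hxy]
  have h2 : walkMean (flipWalk T) (flipBits U) t (fun x y => 1 - G x y)
      = walkMean (flipWalk T) (flipBits U) t (fun _ _ => 1)
        - walkMean (flipWalk T) (flipBits U) t G := by
    simp only [walkMean, mul_sub, Finset.sum_sub_distrib]
  rw [h2, walkMean_const (sum_flipWalk hT)] at h1
  linarith

end Cube

/-! ### Small error, large distance, and no communication -/

section Bounds

/-- For small error the walk flips all bits: a collision among `k + 2` flips is as unlikely as an
error of the protocol. -/
lemma mul_log_le_of_error_le {n k d : ℕ} {δ : ℝ} (hk : 0 < k) (hδ : 0 < δ) (hδ' : δ ≤ 1 / 10 ^ 8)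
    (hkn : (k : ℝ) ^ 2 ≤ δ * n) {G : (Fin n → Bool) → (Fin n → Bool) → ℝ}
    (hG : RectMass G (2 ^ d)) (hG0 : ∀ x y, 0 ≤ G x y) (hG1 : ∀ x y, G x y ≤ 1)
    (hyes : ∀ x y, hammingDist x y = k → 1 - δ ≤ G x y)
    (hno : ∀ x y, hammingDist x y = k + 2 → G x y ≤ δ) :
    k * Real.log (k / δ) ≤ 32 * (d * Real.log 2) := by
  have hk1 : (1 : ℝ) ≤ k := by exact_mod_cast hk
  have hn : (0 : ℝ) < n := by
    by_contra h
    have : δ * n ≤ 0 := mul_nonpos_of_nonneg_of_nonpos hδ.le (not_lt.1 h)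
    nlinarith
  have hT : (Finset.univ : Finset (Fin n)).Nonempty :=
    Finset.card_pos.1 (by simpa using (by exact_mod_cast hn : 0 < n))
  have hTU : Disjoint (Finset.univ : Finset (Fin n)) ∅ := Finset.disjoint_empty_right _
  have h1 := le_walkMean_flipWalk hT hTU hG0 hδ.le (t := k) (by simpa using hyes)
  have h2 := walkMean_flipWalk_le hT hTU hG1 hδ.le (t := k + 2) (by simpa using hno)
  simp only [Finset.card_univ, Fintype.card_fin] at h1 h2
  have h3 : (k : ℝ) ^ 2 / n ≤ δ := by rwa [div_le_iff₀ hn]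
  have h4 : ((k + 2 : ℕ) : ℝ) ^ 2 / n ≤ 9 * δ := by
    rw [div_le_iff₀ hn]
    push_cast
    nlinarith
  have h1' : 7 / 8 ≤ walkMean (flipWalk Finset.univ) (flipBits (∅ : Finset (Fin n))) k G := by
    norm_num at hδ'
    linarith
  have h2' : walkMean (flipWalk Finset.univ) (flipBits (∅ : Finset (Fin n))) (k + 2) G
      ≤ 10 * δ := by linarith
  have hm1 := le_rectMass_mul_exp_log (flipWalk_isSymm _) (flipWalk_nonneg _)
    (flipBits_involutive _) hG hk (by positivity : 0 < 10 * δ) h1' h2'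
  have hlogN : Real.log ((2 : ℝ) ^ d) = d * Real.log 2 := Real.log_pow _ _
  have h2d : (0 : ℝ) < 2 ^ d := by positivity
  have hl1 : -(1 / 3) ≤ d * Real.log 2 + k / 2 * (Real.log 80 + Real.log δ) := by
    have h5 := Real.log_le_log (by norm_num) hm1
    rw [Real.log_mul h2d.ne' (Real.exp_ne_zero _), Real.log_exp, hlogN,
      show 8 * (10 * δ) = 80 * δ by ring, Real.log_mul (by norm_num) hδ.ne'] at h5
    have h6 := Real.one_sub_inv_le_log_of_pos (show (0 : ℝ) < 3 / 4 by norm_num)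
    norm_num at h6 ⊢
    linarith
  have hl80 : 4 * Real.log 80 ≤ - Real.log δ := by
    have h5 : Real.log ((80 : ℝ) ^ 4) ≤ Real.log δ⁻¹ := by
      refine Real.log_le_log (by norm_num) ?_
      rw [le_inv_comm₀ (by norm_num) hδ]
      exact hδ'.trans (by norm_num)
    rw [Real.log_pow, Real.log_inv] at h5
    exact_mod_cast h5
  have hl80' : 1 ≤ Real.log 80 := by
    rw [Real.le_log_iff_exp_le (by norm_num)]
    linarith [Real.exp_one_lt_d9]
  have hmain1 : k * (-Real.log δ) ≤ 4 * (d * Real.log 2) := by nlinarith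
  rw [Real.log_div (by positivity) hδ.ne']
  rcases lt_or_ge (Real.log k) 4 with h4k | h4k
  · nlinarith
  · have hm2 := le_rectMass_mul_exp_mul_log (flipWalk_isSymm _) (flipWalk_nonneg _)
      (sum_flipWalk hT) (flipBits_involutive _) hG hG1 h4k (by positivity : 0 < 10 * δ)
      (by norm_num at hδ'; linarith) h1' h2'
    have h5 := Real.log_le_log (by norm_num) hm2
    rw [Real.log_mul h2d.ne' (Real.exp_ne_zero _), Real.log_exp, hlogN, one_div,
      Real.log_inv] at h5
    have h6 := Real.log_two_lt_d9
    have h7 : Real.log k ≤ k := (Real.log_le_sub_one_of_pos (by positivity)).trans (by linarith)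
    have h8 : 16 ≤ k * Real.log k := by nlinarith
    nlinarith

/-- For constant error the collisions of the walk are reduced by padding: all but `k / 1000` of
the differing bits are fixed. -/
lemma mul_log_le_of_large {n k : ℕ} (hk : 10 ^ 7 ≤ k) (hkn : 2 * k ^ 2 ≤ n)
    {G : (Fin n → Bool) → (Fin n → Bool) → ℝ} {N : ℝ} (hN : 0 < N)
    (hG : RectMass G N) (hG0 : ∀ x y, 0 ≤ G x y) (hG1 : ∀ x y, G x y ≤ 1)
    (hyes : ∀ x y, hammingDist x y = k → 1 - 1 / 2000 ≤ G x y)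
    (hno : ∀ x y, hammingDist x y = k + 2 → G x y ≤ 1 / 2000) :
    k * Real.log k ≤ 32000 * (Real.log N + Real.log 2) := by
  set l := k / 1000 with hl
  have hl1 : 10 ^ 4 ≤ l := by omega
  have hlk : 1000 * l ≤ k := by omega
  have hkl : k ≤ 2000 * l := by omega
  have hkk : k ≤ k ^ 2 := by nlinarith
  obtain ⟨U, -, hU⟩ := Finset.exists_subset_card_eq
    (show k - l ≤ (Finset.univ : Finset (Fin n)).card by rw [Finset.card_fin]; omega)
  have hTc : k ^ 2 ≤ Uᶜ.card := by
    rw [Finset.card_compl, hU, Fintype.card_fin]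
    omega
  have hT : Uᶜ.Nonempty := Finset.card_pos.1 (lt_of_lt_of_le (by positivity) hTc)
  have hTU : Disjoint Uᶜ U := disjoint_compl_left
  have h1 := le_walkMean_flipWalk hT hTU hG0 (by norm_num : (0 : ℝ) ≤ 1 / 2000) (t := l)
    fun x y hxy => hyes x y (by omega)
  have h2 := walkMean_flipWalk_le hT hTU hG1 (by norm_num : (0 : ℝ) ≤ 1 / 2000) (t := l + 2)
    fun x y hxy => hno x y (by omega)
  have hTc' : (k : ℝ) ^ 2 ≤ (Uᶜ.card : ℝ) := by exact_mod_cast hTc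
  have hl1' : (10 : ℝ) ^ 4 ≤ l := by exact_mod_cast hl1
  have hlk' : 1000 * (l : ℝ) ≤ k := by exact_mod_cast hlk
  have hkl' : (k : ℝ) ≤ 2000 * l := by exact_mod_cast hkl
  have hcpos : (0 : ℝ) < (Uᶜ.card : ℝ) := by exact_mod_cast hT.card_pos
  have h4 : ((l + 2 : ℕ) : ℝ) ^ 2 / (Uᶜ.card : ℝ) ≤ 1 / 2000 := by
    rw [div_le_iff₀ hcpos]
    push_cast
    nlinarith
  have h3 : (l : ℝ) ^ 2 / (Uᶜ.card : ℝ) ≤ 1 / 2000 := by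
    refine le_trans ?_ h4
    gcongr
    omega
  have hlog4 : 4 ≤ Real.log l := by
    rw [Real.le_log_iff_exp_le (by linarith)]
    have h5 : Real.exp 4 = Real.exp 1 ^ 4 := by
      rw [← Real.exp_nat_mul]; norm_num
    rw [h5]
    have h6 : Real.exp 1 ≤ 3 := by linarith [Real.exp_one_lt_d9]
    calc Real.exp 1 ^ 4 ≤ 3 ^ 4 := pow_le_pow_left₀ (Real.exp_pos 1).le h6 4
      _ ≤ (10 : ℝ) ^ 4 := by norm_num
      _ ≤ l := hl1'
  have hm := le_rectMass_mul_exp_mul_log (flipWalk_isSymm _) (flipWalk_nonneg _)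
    (sum_flipWalk hT) (flipBits_involutive U) hG hG1 hlog4 (by norm_num : (0 : ℝ) < 1 / 1000)
    (by norm_num) (by linarith) (by linarith)
  have h5 := Real.log_le_log (by norm_num) hm
  rw [Real.log_mul hN.ne' (Real.exp_ne_zero _), Real.log_exp, one_div, Real.log_inv] at h5
  have hlogk : Real.log k ≤ 2 * Real.log l := by
    have h6 : Real.log k ≤ Real.log ((l : ℝ) ^ 2) :=
      Real.log_le_log (by linarith) (by nlinarith)
    rw [Real.log_pow] at h6
    exact_mod_cast h6
  have hlogk0 : 0 ≤ Real.log k := Real.log_nonneg (by linarith)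
  have h6 : (k : ℝ) * Real.log k ≤ 2000 * l * (2 * Real.log l) := by gcongr
  nlinarith

/-- Without communication, `x` and `y` with the uniform distribution look the same at every
distance to the player who declares the output. -/
lemma half_le_of_cost_le_zero {n k : ℕ} (hkn : k + 2 ≤ n) {Ω : Type*} [MeasurableSpace Ω]
    (μ : Measure Ω) [IsProbabilityMeasure μ]
    (P : RandomizedProtocol (Fin n → Bool) (Fin n → Bool) Ω) (hP : P.cost ≤ (0 : ℕ)) {δ : ℝ}
    (hyes : ∀ x y, hammingDist x y = k → 1 - δ ≤ μ.real {ω | (P.run ω).output x y = true})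
    (hno : ∀ x y, hammingDist x y = k + 2 → μ.real {ω | (P.run ω).output x y = true} ≤ δ) :
    1 / 2 ≤ δ := by
  have hset : ∀ j ≤ n, ∃ U : Finset (Fin n), U.card = j := fun j hj => by
    obtain ⟨U, -, hU⟩ := Finset.exists_subset_card_eq
      (show j ≤ (Finset.univ : Finset (Fin n)).card by rwa [Finset.card_fin])
    exact ⟨U, hU⟩
  obtain ⟨U, hU⟩ := hset k (by omega)
  obtain ⟨W, hW⟩ := hset (k + 2) hkn
  have key : ∀ U W : Finset (Fin n),
      ∑ x, μ.real {ω | (P.run ω).output x (flipBits U x) = true}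
        = ∑ x, μ.real {ω | (P.run ω).output x (flipBits W x) = true} := by
    have hrep : ∀ U : Finset (Fin n), ∑ x, μ.real {ω | (P.run ω).output x (flipBits U x) = true}
        = ∫ ω, ∑ x, (if (P.run ω).output x (flipBits U x) = true then (1 : ℝ) else 0) ∂μ := by
      intro U
      have h := P.sum_mul_measureReal_output μ
        (fun x y => if y = flipBits U x then (1 : ℝ) else 0) true
      simpa only [ite_mul, one_mul, zero_mul, Finset.sum_ite_eq', Finset.sum_ite_eq,
        Finset.mem_univ, if_true] using h
    intro U W
    rw [hrep, hrep]
    refine integral_congr_ae (ae_of_all _ fun ω => ?_)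
    have hbits : ∀ x y, (P.run ω).bits x y = 0 := fun x y =>
      Nat.le_zero.1 (P.bits_le_of_cost_le hP ω x y)
    rcases (P.run ω).exists_output_eq_of_bits_eq_zero hbits with ⟨f, hf⟩ | ⟨g, hg⟩
    · simp only [hf]
    · simp only [hg]
      exact (Equiv.sum_comp (flipBits_involutive U).toPerm fun y =>
        if g y = true then (1 : ℝ) else 0).trans
        (Equiv.sum_comp (flipBits_involutive W).toPerm fun y =>
          if g y = true then (1 : ℝ) else 0).symm
  have h1 := Finset.sum_le_sum fun x (_ : x ∈ Finset.univ) =>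
    hyes x (flipBits U x) (by rw [hammingDist_flipBits, hU])
  have h2 := Finset.sum_le_sum fun x (_ : x ∈ Finset.univ) =>
    hno x (flipBits W x) (by rw [hammingDist_flipBits, hW])
  have h3 := h1.trans ((key U W).le.trans h2)
  rw [Finset.sum_const, Finset.sum_const, Finset.card_univ, nsmul_eq_mul, nsmul_eq_mul] at h3
  have hc : (0 : ℝ) < Fintype.card (Fin n → Bool) := by exact_mod_cast Fintype.card_pos
  have := le_of_mul_le_mul_left h3 hc
  linarith

end Bounds

/-! ### The lower bound -/

/-- All versions of the problem ask in particular to tell distance `k` from distance `k + 2`,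
which is already as hard.  By `hm`, a majority vote over `2 * m` runs has error at most
`1 / 2000`. -/
lemma mul_logb_le_of_separates {δ₀ : ℝ} (hδ₀ : δ₀ < 1 / 2) {m : ℕ} (hm0 : 0 < m)
    (hm : ∀ δ, 0 < δ → δ ≤ δ₀ → (4 * (δ * (1 - δ))) ^ m ≤ 1 / 2000)
    {n k : ℕ} {δ : ℝ} (hδ : 0 < δ) (hδ' : δ ≤ δ₀) (hkn : (k : ℝ) ^ 2 ≤ δ * n)
    {Ω : Type*} [MeasurableSpace Ω] (μ : Measure Ω) [IsProbabilityMeasure μ]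
    (P : RandomizedProtocol (Fin n → Bool) (Fin n → Bool) Ω) (d : ℕ) (hP : P.cost ≤ d)
    (hyes : ∀ x y, hammingDist x y = k → 1 - δ ≤ μ.real {ω | (P.run ω).output x y = true})
    (hno : ∀ x y, hammingDist x y = k + 2 → μ.real {ω | (P.run ω).output x y = true} ≤ δ) :
    1 / (10 ^ 9 * m) * (k * Real.logb 2 (k / δ)) ≤ d := by
  have hm1 : (1 : ℝ) ≤ m := by exact_mod_cast hm0
  have hl2 : 0 < Real.log 2 := Real.log_pos (by norm_num)
  rw [one_div, inv_mul_le_iff₀ (by positivity), Real.logb, ← mul_div_assoc,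
    div_le_iff₀ hl2]
  have hd0 : (0 : ℝ) ≤ d := Nat.cast_nonneg d
  rcases Nat.eq_zero_or_pos k with rfl | hk
  · simp only [Nat.cast_zero, zero_mul]
    positivity
  have hk1 : (1 : ℝ) ≤ k := by exact_mod_cast hk
  set G : (Fin n → Bool) → (Fin n → Bool) → ℝ :=
    fun x y => μ.real {ω | (P.run ω).output x y = true} with hGdef
  have hG : RectMass G (2 ^ d) := P.rectMass_measureReal_output μ hP true
  have hG' : RectMass (fun x y => 1 - G x y) (2 ^ d) := by
    have := P.rectMass_measureReal_output μ hP false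
    simpa only [P.measureReal_output_false μ] using this
  have hG0 : ∀ x y, 0 ≤ G x y := fun x y => measureReal_nonneg
  have hG1 : ∀ x y, G x y ≤ 1 := fun x y => measureReal_le_one
  rcases le_or_gt δ (1 / 10 ^ 8) with hsmall | hbig
  · have h1 := mul_log_le_of_error_le hk hδ hsmall hkn hG hG0 hG1 hyes hno
    have h2 : 0 ≤ d * Real.log 2 := by positivity
    nlinarith
  have hlt : 2 * k ^ 2 < n := by
    have hn : (0 : ℝ) < n := by
      by_contra h
      have : δ * n ≤ 0 := mul_nonpos_of_nonneg_of_nonpos hδ.le (not_lt.1 h)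
      nlinarith
    have : 2 * (k : ℝ) ^ 2 < n := by nlinarith
    exact_mod_cast this
  have hd1 : 1 ≤ d := by
    by_contra h
    obtain rfl : d = 0 := by omega
    have := half_le_of_cost_le_zero (by nlinarith) μ P hP hyes hno
    linarith
  have hd1' : (1 : ℝ) ≤ d := by exact_mod_cast hd1
  have hkδ : Real.log (k / δ) ≤ Real.log k + 8 * Real.log 10 := by
    rw [Real.log_div (by positivity) hδ.ne']
    have h1 := Real.log_le_log (by norm_num) hbig.le
    rw [one_div, Real.log_inv, Real.log_pow] at h1
    push_cast at h1
    linarith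
  have hl10 : Real.log 10 ≤ 4 * Real.log 2 := by
    have h1 : Real.log 10 ≤ Real.log ((2 : ℝ) ^ 4) := Real.log_le_log (by norm_num) (by norm_num)
    rw [Real.log_pow] at h1
    exact_mod_cast h1
  rcases lt_or_ge k (10 ^ 7) with hk7 | hk7
  -- Here `k` and `1 / δ` are bounded, so one bit of communication suffices.
  · have hk7' : (k : ℝ) ≤ 10 ^ 7 := by exact_mod_cast hk7.le
    have h1 : Real.log k ≤ 7 * Real.log 10 := by
      have h2 := Real.log_le_log (by positivity) hk7'
      rw [Real.log_pow] at h2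
      exact_mod_cast h2
    have h2 : Real.log (k / δ) ≤ 60 * Real.log 2 := by linarith
    calc (k : ℝ) * Real.log (k / δ) ≤ 10 ^ 7 * (60 * Real.log 2) := by
          refine (mul_le_mul_of_nonneg_left h2 (by positivity)).trans ?_
          gcongr
      _ ≤ 10 ^ 9 * 1 * 1 * Real.log 2 := by nlinarith
      _ ≤ 10 ^ 9 * m * d * Real.log 2 := by gcongr
  · have h1 := mul_log_le_of_large hk7 hlt.le (by positivity)
      (hG.majority hG' (by positivity) m) (fun x y => majority_nonneg m (hG0 x y) (hG1 x y))
      (fun x y => majority_le_one m (hG0 x y) (hG1 x y))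
      (fun x y hxy => by
        have := one_sub_majority_le (m := m) (hG1 x y) (hyes x y hxy) (by linarith)
        linarith [hm δ hδ hδ'])
      (fun x y hxy => (majority_le (hG0 x y) (hno x y hxy) (by linarith)).trans (hm δ hδ hδ'))
    rw [Real.log_pow, Real.log_mul (by norm_num) (by positivity), Real.log_pow] at h1
    have h2 : 7 * Real.log 10 ≤ Real.log k := by
      have hk7' : (10 : ℝ) ^ 7 ≤ k := by exact_mod_cast hk7
      have h2 := Real.log_le_log (by norm_num) hk7'
      rw [Real.log_pow] at h2
      exact_mod_cast h2
    have h3 : Real.log (k / δ) ≤ 3 * Real.log k := by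
      have : 0 ≤ Real.log 10 := Real.log_nonneg (by norm_num)
      linarith
    push_cast at h1
    calc (k : ℝ) * Real.log (k / δ) ≤ k * (3 * Real.log k) := by gcongr
      _ = 3 * (k * Real.log k) := by ring
      _ ≤ 3 * (32000 * (2 * m * (Real.log 2 + d * Real.log 2) + Real.log 2)) := by gcongr
      _ ≤ 3 * (32000 * (2 * m * (d * Real.log 2 + d * Real.log 2) + m * d * Real.log 2)) := by
          have h4 : Real.log 2 ≤ d * Real.log 2 := by nlinarith
          have h5 : Real.log 2 ≤ m * d * Real.log 2 := by nlinarith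
          gcongr
      _ = 480000 * (m * d * Real.log 2) := by ring
      _ ≤ 10 ^ 9 * (m * d * Real.log 2) := by
          have : 0 ≤ m * d * Real.log 2 := by positivity
          nlinarith
      _ = _ := by ring

theorem theorem5 (δ₀ : ℝ) (hδ₀ : δ₀ < 1 / 2) :
    ∃ c : ℝ, 0 < c ∧
      ∀ (n k : ℕ) (δ : ℝ), 0 < δ → δ ≤ δ₀ → (k : ℝ) ^ 2 ≤ δ * n →
      ∀ (Ω : Type*) [MeasurableSpace Ω] (μ : Measure Ω) [IsProbabilityMeasure μ]
        (P : RandomizedProtocol (Fin n → Bool) (Fin n → Bool) Ω) (d : ℕ), P.cost ≤ d →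
        (P.HasErrorOn μ (fun _ _ => True) (hammingProblem n k) δ →
          c * (k * Real.logb 2 (k / δ)) ≤ d) ∧
        (P.HasErrorOn μ (HammingPromise n k) (hammingProblem n k) δ →
          c * (k * Real.logb 2 (k / δ)) ≤ d) ∧
        (P.HasErrorOn μ (HammingPromise n k) (exactHammingProblem n k) δ →
          c * (k * Real.logb 2 (k / δ)) ≤ d) := by
  obtain ⟨m, hm0, hm⟩ : ∃ m : ℕ, 0 < m ∧
      ∀ δ, 0 < δ → δ ≤ δ₀ → (4 * (δ * (1 - δ))) ^ m ≤ 1 / 2000 := by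
    rcases le_or_gt δ₀ 0 with h0 | h0
    · exact ⟨1, one_pos, fun δ h1 h2 => by linarith⟩
    have hlt : 4 * (δ₀ * (1 - δ₀)) < 1 := by nlinarith
    obtain ⟨m, hm⟩ := exists_pow_lt_of_lt_one (show (0 : ℝ) < 1 / 2000 by norm_num) hlt
    refine ⟨m, Nat.pos_of_ne_zero ?_, fun δ h1 h2 => ?_⟩
    · rintro rfl
      norm_num at hm
    · refine (pow_le_pow_left₀ ?_ ?_ m).trans hm.le
      · have : 0 ≤ 1 - δ := by linarith
        positivity
      · nlinarith
  have hm0' : (0 : ℝ) < m := by exact_mod_cast hm0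
  refine ⟨1 / (10 ^ 9 * m), by positivity, ?_⟩
  intro n k δ hδ hδ' hkn Ω _ μ _ P d hP
  have main : ∀ (D : (Fin n → Bool) → (Fin n → Bool) → Prop)
      (F : (Fin n → Bool) → (Fin n → Bool) → Bool), P.HasErrorOn μ D F δ →
      (∀ x y, hammingDist x y = k → D x y ∧ F x y = true) →
      (∀ x y, hammingDist x y = k + 2 → D x y ∧ F x y = false) →
      1 / (10 ^ 9 * m) * (k * Real.logb 2 (k / δ)) ≤ d := by
    intro D F herr hD hD'
    refine mul_logb_le_of_separates hδ₀ hm0 hm hδ hδ' hkn μ P d hP (fun x y hxy => ?_)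
      (fun x y hxy => ?_)
    · obtain ⟨h1, h2⟩ := hD x y hxy
      have h3 := herr x y h1
      simp only [h2, ne_eq, Bool.not_eq_true] at h3
      rw [P.measureReal_output_false μ] at h3
      linarith
    · obtain ⟨h1, h2⟩ := hD' x y hxy
      have h3 := herr x y h1
      simpa only [h2, ne_eq, Bool.not_eq_false] using h3
  refine ⟨fun h => main _ _ h (fun x y hxy => ⟨trivial, ?_⟩) (fun x y hxy => ⟨trivial, ?_⟩),
    fun h => main _ _ h (fun x y hxy => ⟨Or.inr (Or.inl hxy), ?_⟩)
      (fun x y hxy => ⟨Or.inr (Or.inr hxy), ?_⟩),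
    fun h => main _ _ h (fun x y hxy => ⟨Or.inr (Or.inl hxy), ?_⟩)
      (fun x y hxy => ⟨Or.inr (Or.inr hxy), ?_⟩)⟩ <;>
  simp [hammingProblem, exactHammingProblem, hxy]
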